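/- **True cost bounding.** Let $\ell$ range over $\mathbb N\cup\{\infty\}$ and let $k,k'$ (multiplicities) range over positive integers and $\infty$. *The affine language $\lambda^A$.* Types are $!^k_\ell A,\ A\multimap B,\ A\otimes B,\ A\,\&\,B,\ A\oplus B,\ 1,\ \mathbb N,\ \mathrm{list}\,A$. Terms are variables, $\mathtt{tick};M$, $\mathtt{create}_\ell M$, $\mathtt{spend}_\ell M$, $\mathtt{save}^k_\ell M$, $\mathtt{transfer}_{k'}\,!^k_\ell x=M\ \mathtt{to}\ N$, $\lambda x.M$, $M\,N$, $(M,N)$, $\mathtt{split}_{k'}(M,x.y.N)$, lazy pairs $\langle M,N\rangle$, $\pi_iM$, $\mathtt{inl}\,M$, $\mathtt{inr}\,M$, $\mathtt{case}_{k'}(M,x.N_1,y.N_2)$, $()$, $0$, $S(M)$, $\mathtt{nrec}(M,N_1,N_2)$, $[\,]$, $M::N$, $\mathtt{lrec}(M,N_1,N_2)$. The judgment $\Gamma\vdash_f M:A$ has a resource term $f=\sum_i a_ix_i+\ell$ over the variables of $\Gamma$, with $a_i,\ell\in\mathbb N\cup\{\infty\}$ (coefficient-wise sums, multiples and order; $0\cdot\infty=0$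 and $\infty\cdot a=\infty$ for $a\ne0$). Its rules are: - $\Gamma\vdash_f x_i:A_i$ if $f\ge x_i$; further $\Gamma\vdash_f():1$, $\Gamma\vdash_f 0:\mathbb N$ and $\Gamma\vdash_f[\,]:\mathrm{list}\,A$; - $\mathtt{tick};M$, $S(M)$, $\pi_iM$, $\mathtt{inl}\,M$, $\mathtt{inr}\,M$ have the evident types and the resources of $M$; $\langle M,N\rangle:A\,\&\,B$ has resources $f$ if both $M:A$ and $N:B$ have resources $f$; - if $\vdash_{f+\ell}M:A$ then $\vdash_f\mathtt{create}_\ell M:A$; if $\vdash_fM:A$ then $\vdash_{f+\ell}\mathtt{spend}_\ell M:A$; - if $\vdash_fM:A$ and $g\ge kf+\ell$ then $\vdash_g\mathtt{save}^k_\ell M:{!^k_\ell A}$; - if $\vdash_fM:{!^k_\ell A}$ and $x:A\vdash_{g+k'kx+k'\ell}N:C$ then $\vdash_{k'f+g}\mathtt{transfer}_{k'}\,!^k_\ell x=M\ \mathtt{to}\ N:C$; - if $x:A\vdash_{f+x}M:B$ then $\vdash_f\lambda x.M:A\multimap B$; applications, eager pairs ($\otimes$) and $::$ have the sum of the resources of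 their parts; - if $\vdash_fM:A\otimes B$ and $x:A,y:B\vdash_{g+k'x+k'y}N:C$ then $\vdash_{k'f+g}\mathtt{split}_{k'}(M,x.y.N):C$; if $\vdash_fM:A\oplus B$, $x:A\vdash_{g+k'x}N_1:C$ and $y:B\vdash_{g+k'y}N_2:C$ then $\vdash_{k'f+g}\mathtt{case}_{k'}(M,x.N_1,y.N_2):C$; - $\mathtt{nrec}(M,N_1,N_2):C$ for $M:\mathbb N$, $N_1:1\multimap C$, $N_2:{!^\infty_0(\mathbb N\otimes(1\multimap C)\multimap C)}$, and $\mathtt{lrec}(M,N_1,N_2):C$ for $M:\mathrm{list}\,A$, $N_1:1\multimap C$, $N_2:{!^\infty_0(A\otimes(\mathrm{list}\,A\,\&\,C)\multimap C)}$, with the sum of the three resource terms. *Evaluation.* $M\Downarrow^{(n,r)}v$ is call-by-value big-step evaluation of closed terms; $n\in\mathbb N$ counts ticks and $r\in\mathbb Z\cup\{\pm\infty\}$ is credits created minus credits spent. Unless stated otherwise the pairs $(n,r)$ of the subevaluations are added. $\mathtt{tick}$ adds $1$ to $n$; $\mathtt{create}_\ell$ adds $\ell$ to $r$; $\mathtt{spend}_\ell$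 adds $-\ell$ to $r$; $\mathtt{save}^k_\ell M$ evaluates to $\mathtt{save}^k_\ell v$ with $(n,kr)$ if $M\Downarrow^{(n,r)}v$; in $\mathtt{transfer}_{k'},\mathtt{split}_{k'},\mathtt{case}_{k'}$ the balance $r_1$ of the scrutinee counts $k'$ times, and the value(s) found are substituted in the body. Functions and lazy pairs are values (cost $(0,0)$); projections evaluate the chosen component. A recursor first evaluates its arguments to a number or list, to $\lambda x.N_1'$ and to $\mathtt{save}^\infty_0(\lambda x.N_2')$; then it evaluates $N_1'[()/x]$ for $0$ and $[\,]$, and $N_2'[(v,\lambda z.\mathtt{nrec}(v,\lambda x.N_1',\mathtt{save}^\infty_0\lambda x.N_2'))/x]$ for $S(v)$, respectively $N_2'[(v_1,\langle v_2,\mathtt{lrec}(v_2,\lambda x.N_1',\mathtt{save}^\infty_0\lambda x.N_2')\rangle)/x]$ for $v_1::v_2$. *Costs.* Let $R$ be any linearly ordered commutative ring with $0<1$ whose order is strictly compatible with the operations (typically $\mathbb Z$), and let $\bar R=R\cup\{\infty,-\infty\}$ with $\infty+x=\infty$ for all $x$, $-\infty+x=-\infty$ for $x\neq\infty$, $\infty\cdot0=0$,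 and $\infty\cdot x=\pm\infty$ according to the sign of $x\ne0$. The same conventions are used for $r$. *The recurrence language $\lambda^{\mathbb C}$* is the simply typed $\lambda$-calculus with types $\mathbb C,1,\mathbb N,\mathrm{list}\,T,\times,+,\to$. Its terms are the usual introduction and elimination forms together with cost constants $c\in\bar R$, sums $E+E'$ and multiples $k\cdot E$ of terms of type $\mathbb C$, and recursors $\mathtt{nrec}(E,E_1,E_2):T$ (with $E:\mathbb N$, $E_1:1\to T$, $E_2:\mathbb N\times T\to T$) and $\mathtt{lrec}(E,E_1,E_2):T$ (with $E:\mathrm{list}\,T_1$, $E_1:1\to T$, $E_2:T_1\times(\mathrm{list}\,T_1\times T)\to T$). The judgment $\Gamma\vdash E\le_TE'$ between terms of type $T$ is the least preorder such that: constants are ordered, added and multiplied by $k$ as in $\bar R$; $+$ satisfies the commutative monoid laws; $+$ and $k\cdot$ are monotone; elimination forms are monotone in the principal argument; and every $\beta$-reduct is $\le$ its redex (where $E_1\,()$ is the reduct of $\mathtt{nrec}(0,E_1,E_2)$ and of $\mathtt{lrec}([\,],E_1,E_2)$, $E_2(E,\mathtt{nrec}(E,E_1,E_2))$ that of $\mathtt{nrec}(S(E),E_1,E_2)$,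 and $E_2(E,(E',\mathtt{lrec}(E',E_1,E_2)))$ that of $\mathtt{lrec}(E::E',E_1,E_2)$). *Extraction.* Let $E_c=\pi_1E$, $E_p=\pi_2E$ and $E+_cE'=(E+E'_c,E'_p)$. The extracted recurrence $\|M\|$ is $\|x\|=(0,x)$; $\|\mathtt{tick};M\|=1+_c\|M\|$; $\|\mathtt{create}_\ell M\|=\ell+_c\|M\|$; $\|\mathtt{spend}_\ell M\|=(-\ell)+_c\|M\|$; $\|\mathtt{save}^k_\ell M\|=(k\|M\|_c,\|M\|_p)$; $\|\mathtt{transfer}_{k'}\,!^k_\ell x=M\ \mathtt{to}\ N\|=k'\|M\|_c+_c\|N\|[\|M\|_p/x]$; $\|\lambda x.M\|=(0,\lambda x.\|M\|)$; $\|M\,N\|=(\|M\|_c+\|N\|_c)+_c\|M\|_p\,\|N\|_p$; $\|\mathtt{split}_{k'}(M,x.y.N)\|=k'\|M\|_c+_c\|N\|[\pi_1\|M\|_p/x,\pi_2\|M\|_p/y]$; $\|\langle M,N\rangle\|=(0,(\|M\|,\|N\|))$; $\|\pi_iM\|=\|M\|_c+_c\pi_i\|M\|_p$; $\|\mathtt{case}_{k'}(M,x.N_1,y.N_2)\|=k'\|M\|_c+_c\mathtt{case}(\|M\|_p,x.\|N_1\|,y.\|N_2\|)$;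 eager constructors $()$, $0$, $S$, $[\,]$, $::$, $(\,,)$, $\mathtt{inl}$, $\mathtt{inr}$ add the costs of their arguments and apply the constructor to their potentials; $\|\mathtt{nrec}(M,N_1,N_2)\|=(\|M\|_c+\|N_1\|_c+\|N_2\|_c)+_c\mathtt{nrec}(\|M\|_p,\|N_1\|_p,\lambda p.\|N_2\|_p(\pi_1p,\lambda z.\pi_2p))$; $\|\mathtt{lrec}(M,N_1,N_2)\|=(\|M\|_c+\|N_1\|_c+\|N_2\|_c)+_c\mathtt{lrec}(\|M\|_p,\|N_1\|_p,\lambda p.\|N_2\|_p(\pi_1p,((0,\pi_1\pi_2p),\pi_2\pi_2p)))$. **Corollary.** If $\cdot\vdash_0M:A$ (no external credits) and $M\Downarrow^{(n,r)}v$, then $\cdot\vdash n\le_{\mathbb C}\|M\|_c$: the number $n$ of ticks is at most the cost component of the extracted recurrence, in the inequality judgment of $\lambda^{\mathbb C}$. -/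

import Mathlib

/-! # Arithmetic of costs and multiplicities -/

/-- A multiplicity: a positive natural number or `∞`. -/
abbrev Mult : Type := {k : ℕ∞ // 1 ≤ k}

namespace Mult

def one : Mult := ⟨1, le_refl 1⟩

def infty : Mult := ⟨⊤, le_top⟩

end Mult

/-- An ordered ring `R` extended by `∞ = ⊤` and by its negative `-∞`.  The sum `∞ + x` is `∞` for
every `x` (also for `x = -∞`), and `-∞ + x` is `-∞` for every other `x`. -/
abbrev ExtCost (R : Type*) : Type _ := WithTop (WithBot R)

namespace ExtCost

/-- A ring element, seen as an extended one. -/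
def fin {R : Type*} (x : R) : ExtCost R := ((x : WithBot R) : WithTop (WithBot R))

/-- `-∞`. -/
def negInfty {R : Type*} : ExtCost R := ((⊥ : WithBot R) : WithTop (WithBot R))

/-- The number `ℓ` of credits, as an extended ring element. -/
noncomputable def credit (R : Type*) [CommRing R] (l : ℕ∞) : ExtCost R :=
  if l = ⊤ then ⊤ else fin (l.toNat : R)

/-- The extended ring element `-ℓ`. -/
noncomputable def debit (R : Type*) [CommRing R] (l : ℕ∞) : ExtCost R :=
  if l = ⊤ then negInfty else fin (-(l.toNat : R))

/-- `k · x` for a multiplicity `k`: the `k`-fold sum of `x` if `k` is finite; for `k = ∞` it is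
`0` if `x = 0`, it is `∞` if `x > 0`, and it is `-∞` if `x < 0`. -/
noncomputable def scale {R : Type*} [CommRing R] [LinearOrder R] (k : Mult) (x : ExtCost R) :
    ExtCost R :=
  if k.1 = ⊤ then (if x = 0 then 0 else if 0 < x then ⊤ else negInfty) else k.1.toNat • x

end ExtCost

/-- The credit balance of an evaluation (credits created minus credits spent). -/
abbrev Balance : Type := ExtCost ℤ

/-! # The affine language with credits -/

namespace LamA

/-- Types: `!^k_ℓ A`, `A ⊸ B`, `A ⊗ B`, `A & B`, `A ⊕ B`, `1`, `ℕ`, `list A`. -/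
inductive Ty : Type
  | bang (k : Mult) (l : ℕ∞) (A : Ty)
  | lolli (A B : Ty)
  | tensor (A B : Ty)
  | amp (A B : Ty)
  | oplus (A B : Ty)
  | one
  | nat
  | list (A : Ty)

/-- Terms with `n` free variables (de Bruijn indices, `0` is the variable bound last).
`transfer j k l M N` is `transfer_j !^k_l x = M to N`; `letPair j M N` is
`split_j (M, x.y.N)` where `x` has index `1` and `y` has index `0` in `N`;
`caseOf j M N₁ N₂` is `case_j (M, x.N₁, y.N₂)`; `lazyPair M N` is the element `⟨M, N⟩` of
`A & B`, with projections `fst` and `snd`. -/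
inductive Tm : ℕ → Type
  | var {n : ℕ} (i : Fin n) : Tm n
  | tick {n : ℕ} (M : Tm n) : Tm n
  | create {n : ℕ} (l : ℕ∞) (M : Tm n) : Tm n
  | spend {n : ℕ} (l : ℕ∞) (M : Tm n) : Tm n
  | save {n : ℕ} (k : Mult) (l : ℕ∞) (M : Tm n) : Tm n
  | transfer {n : ℕ} (j k : Mult) (l : ℕ∞) (M : Tm n) (N : Tm (n + 1)) : Tm n
  | lam {n : ℕ} (M : Tm (n + 1)) : Tm n
  | app {n : ℕ} (M N : Tm n) : Tm n
  | pair {n : ℕ} (M N : Tm n) : Tm n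
  | letPair {n : ℕ} (j : Mult) (M : Tm n) (N : Tm (n + 2)) : Tm n
  | lazyPair {n : ℕ} (M N : Tm n) : Tm n
  | fst {n : ℕ} (M : Tm n) : Tm n
  | snd {n : ℕ} (M : Tm n) : Tm n
  | inl {n : ℕ} (M : Tm n) : Tm n
  | inr {n : ℕ} (M : Tm n) : Tm n
  | caseOf {n : ℕ} (j : Mult) (M : Tm n) (N₁ N₂ : Tm (n + 1)) : Tm n
  | triv {n : ℕ} : Tm n
  | zero {n : ℕ} : Tm n
  | succ {n : ℕ} (M : Tm n) : Tm n
  | nrec {n : ℕ} (M N₁ N₂ : Tm n) : Tm n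
  | nil {n : ℕ} : Tm n
  | cons {n : ℕ} (M N : Tm n) : Tm n
  | lrec {n : ℕ} (M N₁ N₂ : Tm n) : Tm n

namespace Tm

/-- Extension of a renaming under a binder. -/
def up {n m : ℕ} (ρ : Fin n → Fin m) : Fin (n + 1) → Fin (m + 1) :=
  Matrix.vecCons 0 (fun i => (ρ i).succ)

def rename : {n m : ℕ} → (Fin n → Fin m) → Tm n → Tm m
  | _, _, ρ, var i => var (ρ i)
  | _, _, ρ, tick M => tick (rename ρ M)
  | _, _, ρ, create l M => create l (rename ρ M)
  | _, _, ρ, spend l M => spend l (rename ρ M)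
  | _, _, ρ, save k l M => save k l (rename ρ M)
  | _, _, ρ, transfer j k l M N => transfer j k l (rename ρ M) (rename (up ρ) N)
  | _, _, ρ, lam M => lam (rename (up ρ) M)
  | _, _, ρ, app M N => app (rename ρ M) (rename ρ N)
  | _, _, ρ, pair M N => pair (rename ρ M) (rename ρ N)
  | _, _, ρ, letPair j M N => letPair j (rename ρ M) (rename (up (up ρ)) N)
  | _, _, ρ, lazyPair M N => lazyPair (rename ρ M) (rename ρ N)
  | _, _, ρ, fst M => fst (rename ρ M)
  | _, _, ρ, snd M => snd (rename ρ M)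
  | _, _, ρ, inl M => inl (rename ρ M)
  | _, _, ρ, inr M => inr (rename ρ M)
  | _, _, ρ, caseOf j M N₁ N₂ =>
      caseOf j (rename ρ M) (rename (up ρ) N₁) (rename (up ρ) N₂)
  | _, _, _, triv => triv
  | _, _, _, zero => zero
  | _, _, ρ, succ M => succ (rename ρ M)
  | _, _, ρ, nrec M N₁ N₂ => nrec (rename ρ M) (rename ρ N₁) (rename ρ N₂)
  | _, _, _, nil => nil
  | _, _, ρ, cons M N => cons (rename ρ M) (rename ρ N)
  | _, _, ρ, lrec M N₁ N₂ => lrec (rename ρ M) (rename ρ N₁) (rename ρ N₂)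

/-- The term, seen in a context with one more (unused) variable. -/
def weaken {n : ℕ} (M : Tm n) : Tm (n + 1) := rename Fin.succ M

/-- Extension of a substitution under a binder. -/
def lift {n m : ℕ} (σ : Fin n → Tm m) : Fin (n + 1) → Tm (m + 1) :=
  Matrix.vecCons (var 0) (fun i => weaken (σ i))

/-- Simultaneous capture-avoiding substitution. -/
def subst : {n m : ℕ} → (Fin n → Tm m) → Tm n → Tm m
  | _, _, σ, var i => σ i
  | _, _, σ, tick M => tick (subst σ M)
  | _, _, σ, create l M => create l (subst σ M)
  | _, _, σ, spend l M => spend l (subst σ M)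
  | _, _, σ, save k l M => save k l (subst σ M)
  | _, _, σ, transfer j k l M N => transfer j k l (subst σ M) (subst (lift σ) N)
  | _, _, σ, lam M => lam (subst (lift σ) M)
  | _, _, σ, app M N => app (subst σ M) (subst σ N)
  | _, _, σ, pair M N => pair (subst σ M) (subst σ N)
  | _, _, σ, letPair j M N => letPair j (subst σ M) (subst (lift (lift σ)) N)
  | _, _, σ, lazyPair M N => lazyPair (subst σ M) (subst σ N)
  | _, _, σ, fst M => fst (subst σ M)
  | _, _, σ, snd M => snd (subst σ M)
  | _, _, σ, inl M => inl (subst σ M)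
  | _, _, σ, inr M => inr (subst σ M)
  | _, _, σ, caseOf j M N₁ N₂ =>
      caseOf j (subst σ M) (subst (lift σ) N₁) (subst (lift σ) N₂)
  | _, _, _, triv => triv
  | _, _, _, zero => zero
  | _, _, σ, succ M => succ (subst σ M)
  | _, _, σ, nrec M N₁ N₂ => nrec (subst σ M) (subst σ N₁) (subst σ N₂)
  | _, _, _, nil => nil
  | _, _, σ, cons M N => cons (subst σ M) (subst σ N)
  | _, _, σ, lrec M N₁ N₂ => lrec (subst σ M) (subst σ N₁) (subst σ N₂)

/-- `M[N/x]` for the variable `x` of index `0`. -/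
def subst1 {n : ℕ} (M : Tm (n + 1)) (N : Tm n) : Tm n :=
  subst (Matrix.vecCons N var) M

/-- `M[N₁/x, N₂/y]` for the variables `x` of index `1` and `y` of index `0`. -/
def subst2 {n : ℕ} (M : Tm (n + 2)) (N₁ N₂ : Tm n) : Tm n :=
  subst (Matrix.vecCons N₂ (Matrix.vecCons N₁ var)) M

end Tm

/-- Contexts. -/
abbrev Ctx (n : ℕ) : Type := Fin n → Ty

/-- The resource term `a₁ x₁ + ⋯ + aₙ xₙ + ℓ`, given by its coefficients and its bank `ℓ`.
Sums, multiples and the order are coefficient-wise; `0 · ∞ = 0` and `∞ · k = ∞` for `k ≠ 0`. -/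
abbrev Res (n : ℕ) : Type := (Fin n → ℕ∞) × ℕ∞

/-- The resource term that consists of `ℓ` credits. -/
def Res.credits {n : ℕ} (l : ℕ∞) : Res n := (0, l)

/-- The resource term `f + a x`, for a new variable `x` (of index `0`). -/
def Res.snoc {n : ℕ} (f : Res n) (a : ℕ∞) : Res (n + 1) := (Matrix.vecCons a f.1, f.2)

/-- The context `Γ, x : A`, where `x` gets index `0`. -/
def Ctx.snoc {n : ℕ} (Γ : Ctx n) (A : Ty) : Ctx (n + 1) := Matrix.vecCons A Γ

/-- The typing judgment `Γ ⊢_f M : A`. -/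
inductive HasType : {n : ℕ} → Ctx n → Res n → Tm n → Ty → Prop
  | var {n : ℕ} {Γ : Ctx n} {f : Res n} (i : Fin n) (h : 1 ≤ f.1 i) :
      HasType Γ f (.var i) (Γ i)
  | tick {n : ℕ} {Γ : Ctx n} {f : Res n} {M : Tm n} {A : Ty} :
      HasType Γ f M A → HasType Γ f (.tick M) A
  | create {n : ℕ} {Γ : Ctx n} {f : Res n} {l : ℕ∞} {M : Tm n} {A : Ty} :
      HasType Γ (f + Res.credits l) M A → HasType Γ f (.create l M) A
  | spend {n : ℕ} {Γ : Ctx n} {f f' : Res n} {l : ℕ∞} {M : Tm n} {A : Ty} :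
      HasType Γ f M A → f' = f + Res.credits l → HasType Γ f' (.spend l M) A
  | save {n : ℕ} {Γ : Ctx n} {f g : Res n} {k : Mult} {l : ℕ∞} {M : Tm n} {A : Ty} :
      HasType Γ f M A → k.1 • f + Res.credits l ≤ g →
      HasType Γ g (.save k l M) (.bang k l A)
  | transfer {n : ℕ} {Γ : Ctx n} {f g h : Res n} {j k : Mult} {l : ℕ∞} {M : Tm n}
      {N : Tm (n + 1)} {A C : Ty} :
      HasType Γ f M (.bang k l A) →
      HasType (Γ.snoc A) (Res.snoc (g + Res.credits (j.1 * l)) (j.1 * k.1)) N C →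
      h = j.1 • f + g → HasType Γ h (.transfer j k l M N) C
  | lam {n : ℕ} {Γ : Ctx n} {f : Res n} {M : Tm (n + 1)} {A B : Ty} :
      HasType (Γ.snoc A) (Res.snoc f 1) M B → HasType Γ f (.lam M) (.lolli A B)
  | app {n : ℕ} {Γ : Ctx n} {f g h : Res n} {M N : Tm n} {A B : Ty} :
      HasType Γ f M (.lolli A B) → HasType Γ g N A → h = f + g → HasType Γ h (.app M N) B
  | pair {n : ℕ} {Γ : Ctx n} {f g h : Res n} {M N : Tm n} {A B : Ty} :
      HasType Γ f M A → HasType Γ g N B → h = f + g → HasType Γ h (.pair M N) (.tensor A B)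
  | letPair {n : ℕ} {Γ : Ctx n} {f g h : Res n} {j : Mult} {M : Tm n} {N : Tm (n + 2)}
      {A B C : Ty} :
      HasType Γ f M (.tensor A B) →
      HasType ((Γ.snoc A).snoc B) (Res.snoc (Res.snoc g j.1) j.1) N C →
      h = j.1 • f + g → HasType Γ h (.letPair j M N) C
  | lazyPair {n : ℕ} {Γ : Ctx n} {f : Res n} {M N : Tm n} {A B : Ty} :
      HasType Γ f M A → HasType Γ f N B → HasType Γ f (.lazyPair M N) (.amp A B)
  | fst {n : ℕ} {Γ : Ctx n} {f : Res n} {M : Tm n} {A B : Ty} :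
      HasType Γ f M (.amp A B) → HasType Γ f (.fst M) A
  | snd {n : ℕ} {Γ : Ctx n} {f : Res n} {M : Tm n} {A B : Ty} :
      HasType Γ f M (.amp A B) → HasType Γ f (.snd M) B
  | inl {n : ℕ} {Γ : Ctx n} {f : Res n} {M : Tm n} {A B : Ty} :
      HasType Γ f M A → HasType Γ f (.inl M) (.oplus A B)
  | inr {n : ℕ} {Γ : Ctx n} {f : Res n} {M : Tm n} {A B : Ty} :
      HasType Γ f M B → HasType Γ f (.inr M) (.oplus A B)
  | caseOf {n : ℕ} {Γ : Ctx n} {f g h : Res n} {j : Mult} {M : Tm n} {N₁ N₂ : Tm (n + 1)}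
      {A B C : Ty} :
      HasType Γ f M (.oplus A B) →
      HasType (Γ.snoc A) (Res.snoc g j.1) N₁ C → HasType (Γ.snoc B) (Res.snoc g j.1) N₂ C →
      h = j.1 • f + g → HasType Γ h (.caseOf j M N₁ N₂) C
  | triv {n : ℕ} {Γ : Ctx n} {f : Res n} : HasType Γ f .triv .one
  | zero {n : ℕ} {Γ : Ctx n} {f : Res n} : HasType Γ f .zero .nat
  | succ {n : ℕ} {Γ : Ctx n} {f : Res n} {M : Tm n} :
      HasType Γ f M .nat → HasType Γ f (.succ M) .nat
  | nrec {n : ℕ} {Γ : Ctx n} {f g h f' : Res n} {M N₁ N₂ : Tm n} {C : Ty} :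
      HasType Γ f M .nat → HasType Γ g N₁ (.lolli .one C) →
      HasType Γ h N₂ (.bang .infty 0 (.lolli (.tensor .nat (.lolli .one C)) C)) →
      f' = f + g + h → HasType Γ f' (.nrec M N₁ N₂) C
  | nil {n : ℕ} {Γ : Ctx n} {f : Res n} {A : Ty} : HasType Γ f .nil (.list A)
  | cons {n : ℕ} {Γ : Ctx n} {f g h : Res n} {M N : Tm n} {A : Ty} :
      HasType Γ f M A → HasType Γ g N (.list A) → h = f + g → HasType Γ h (.cons M N) (.list A)
  | lrec {n : ℕ} {Γ : Ctx n} {f g h f' : Res n} {M N₁ N₂ : Tm n} {A C : Ty} :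
      HasType Γ f M (.list A) → HasType Γ g N₁ (.lolli .one C) →
      HasType Γ h N₂ (.bang .infty 0 (.lolli (.tensor A (.amp (.list A) C)) C)) →
      f' = f + g + h → HasType Γ f' (.lrec M N₁ N₂) C

/-- The evaluation judgment `M ↓^(n, r) v`: the closed term `M` evaluates to the value `v` with
`n` ticks and credit balance `r`. -/
inductive Eval : Tm 0 → ℕ → Balance → Tm 0 → Prop
  | tick {M v : Tm 0} {n : ℕ} {r : Balance} :
      Eval M n r v → Eval (.tick M) (n + 1) r v
  | create {l : ℕ∞} {M v : Tm 0} {n : ℕ} {r : Balance} :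
      Eval M n r v → Eval (.create l M) n (r + ExtCost.credit ℤ l) v
  | spend {l : ℕ∞} {M v : Tm 0} {n : ℕ} {r : Balance} :
      Eval M n r v → Eval (.spend l M) n (r + ExtCost.debit ℤ l) v
  | save {k : Mult} {l : ℕ∞} {M v : Tm 0} {n : ℕ} {r : Balance} :
      Eval M n r v → Eval (.save k l M) n (ExtCost.scale k r) (.save k l v)
  | transfer {j k : Mult} {l : ℕ∞} {M v w : Tm 0} {N : Tm 1} {n₁ n₂ : ℕ} {r₁ r₂ : Balance} :
      Eval M n₁ r₁ (.save k l v) → Eval (N.subst1 v) n₂ r₂ w →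
      Eval (.transfer j k l M N) (n₁ + n₂) (ExtCost.scale j r₁ + r₂) w
  | lam {M : Tm 1} : Eval (.lam M) 0 0 (.lam M)
  | app {M N v w : Tm 0} {M' : Tm 1} {n₁ n₂ n₃ : ℕ} {r₁ r₂ r₃ : Balance} :
      Eval M n₁ r₁ (.lam M') → Eval N n₂ r₂ v → Eval (M'.subst1 v) n₃ r₃ w →
      Eval (.app M N) (n₁ + n₂ + n₃) (r₁ + r₂ + r₃) w
  | pair {M N v w : Tm 0} {n₁ n₂ : ℕ} {r₁ r₂ : Balance} :
      Eval M n₁ r₁ v → Eval N n₂ r₂ w → Eval (.pair M N) (n₁ + n₂) (r₁ + r₂) (.pair v w)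
  | letPair {j : Mult} {M v₁ v₂ w : Tm 0} {N : Tm 2} {n₁ n₂ : ℕ} {r₁ r₂ : Balance} :
      Eval M n₁ r₁ (.pair v₁ v₂) → Eval (N.subst2 v₁ v₂) n₂ r₂ w →
      Eval (.letPair j M N) (n₁ + n₂) (ExtCost.scale j r₁ + r₂) w
  | lazyPair {M N : Tm 0} : Eval (.lazyPair M N) 0 0 (.lazyPair M N)
  | fst {M N₁ N₂ v : Tm 0} {n₁ n₂ : ℕ} {r₁ r₂ : Balance} :
      Eval M n₁ r₁ (.lazyPair N₁ N₂) → Eval N₁ n₂ r₂ v → Eval (.fst M) (n₁ + n₂) (r₁ + r₂) v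
  | snd {M N₁ N₂ v : Tm 0} {n₁ n₂ : ℕ} {r₁ r₂ : Balance} :
      Eval M n₁ r₁ (.lazyPair N₁ N₂) → Eval N₂ n₂ r₂ v → Eval (.snd M) (n₁ + n₂) (r₁ + r₂) v
  | inl {M v : Tm 0} {n : ℕ} {r : Balance} : Eval M n r v → Eval (.inl M) n r (.inl v)
  | inr {M v : Tm 0} {n : ℕ} {r : Balance} : Eval M n r v → Eval (.inr M) n r (.inr v)
  | caseInl {j : Mult} {M v w : Tm 0} {N₁ N₂ : Tm 1} {n₁ n₂ : ℕ} {r₁ r₂ : Balance} :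
      Eval M n₁ r₁ (.inl v) → Eval (N₁.subst1 v) n₂ r₂ w →
      Eval (.caseOf j M N₁ N₂) (n₁ + n₂) (ExtCost.scale j r₁ + r₂) w
  | caseInr {j : Mult} {M v w : Tm 0} {N₁ N₂ : Tm 1} {n₁ n₂ : ℕ} {r₁ r₂ : Balance} :
      Eval M n₁ r₁ (.inr v) → Eval (N₂.subst1 v) n₂ r₂ w →
      Eval (.caseOf j M N₁ N₂) (n₁ + n₂) (ExtCost.scale j r₁ + r₂) w
  | triv : Eval .triv 0 0 .triv
  | zero : Eval .zero 0 0 .zero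
  | succ {M v : Tm 0} {n : ℕ} {r : Balance} : Eval M n r v → Eval (.succ M) n r (.succ v)
  | nrecZero {M N₁ N₂ w : Tm 0} {N₁' N₂' : Tm 1} {n₁ n₂ n₃ n₄ : ℕ} {r₁ r₂ r₃ r₄ : Balance} :
      Eval M n₁ r₁ .zero → Eval N₁ n₂ r₂ (.lam N₁') →
      Eval N₂ n₃ r₃ (.save .infty 0 (.lam N₂')) →
      Eval (N₁'.subst1 .triv) n₄ r₄ w →
      Eval (.nrec M N₁ N₂) (n₁ + n₂ + n₃ + n₄) (r₁ + r₂ + r₃ + r₄) w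
  | nrecSucc {M N₁ N₂ v w : Tm 0} {N₁' N₂' : Tm 1} {n₁ n₂ n₃ n₄ : ℕ} {r₁ r₂ r₃ r₄ : Balance} :
      Eval M n₁ r₁ (.succ v) → Eval N₁ n₂ r₂ (.lam N₁') →
      Eval N₂ n₃ r₃ (.save .infty 0 (.lam N₂')) →
      Eval (N₂'.subst1
        (.pair v (.lam (Tm.weaken (.nrec v (.lam N₁') (.save .infty 0 (.lam N₂'))))))) n₄ r₄ w →
      Eval (.nrec M N₁ N₂) (n₁ + n₂ + n₃ + n₄) (r₁ + r₂ + r₃ + r₄) w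
  | nil : Eval .nil 0 0 .nil
  | cons {M N v w : Tm 0} {n₁ n₂ : ℕ} {r₁ r₂ : Balance} :
      Eval M n₁ r₁ v → Eval N n₂ r₂ w → Eval (.cons M N) (n₁ + n₂) (r₁ + r₂) (.cons v w)
  | lrecNil {M N₁ N₂ w : Tm 0} {N₁' N₂' : Tm 1} {n₁ n₂ n₃ n₄ : ℕ} {r₁ r₂ r₃ r₄ : Balance} :
      Eval M n₁ r₁ .nil → Eval N₁ n₂ r₂ (.lam N₁') →
      Eval N₂ n₃ r₃ (.save .infty 0 (.lam N₂')) →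
      Eval (N₁'.subst1 .triv) n₄ r₄ w →
      Eval (.lrec M N₁ N₂) (n₁ + n₂ + n₃ + n₄) (r₁ + r₂ + r₃ + r₄) w
  | lrecCons {M N₁ N₂ v₁ v₂ w : Tm 0} {N₁' N₂' : Tm 1} {n₁ n₂ n₃ n₄ : ℕ}
      {r₁ r₂ r₃ r₄ : Balance} :
      Eval M n₁ r₁ (.cons v₁ v₂) → Eval N₁ n₂ r₂ (.lam N₁') →
      Eval N₂ n₃ r₃ (.save .infty 0 (.lam N₂')) →
      Eval (N₂'.subst1
        (.pair v₁ (.lazyPair v₂ (.lrec v₂ (.lam N₁') (.save .infty 0 (.lam N₂')))))) n₄ r₄ w →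
      Eval (.lrec M N₁ N₂) (n₁ + n₂ + n₃ + n₄) (r₁ + r₂ + r₃ + r₄) w

end LamA

/-! # The recurrence language -/

namespace LamC

/-- Types: `ℂ`, `1`, `ℕ`, `list T`, `T₁ × T₂`, `T₁ + T₂`, `T₁ → T₂`. -/
inductive Ty : Type
  | cost
  | one
  | nat
  | list (T : Ty)
  | prod (T₁ T₂ : Ty)
  | sum (T₁ T₂ : Ty)
  | arr (T₁ T₂ : Ty)

/-- Terms with `n` free variables; the cost constants are the elements of `ExtCost R`. -/
inductive Tm (R : Type*) : ℕ → Type _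
  | var {n : ℕ} (i : Fin n) : Tm R n
  | const {n : ℕ} (c : ExtCost R) : Tm R n
  | plus {n : ℕ} (E₁ E₂ : Tm R n) : Tm R n
  | times {n : ℕ} (k : Mult) (E : Tm R n) : Tm R n
  | lam {n : ℕ} (E : Tm R (n + 1)) : Tm R n
  | app {n : ℕ} (E₁ E₂ : Tm R n) : Tm R n
  | triv {n : ℕ} : Tm R n
  | pair {n : ℕ} (E₁ E₂ : Tm R n) : Tm R n
  | fst {n : ℕ} (E : Tm R n) : Tm R n
  | snd {n : ℕ} (E : Tm R n) : Tm R n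
  | inl {n : ℕ} (E : Tm R n) : Tm R n
  | inr {n : ℕ} (E : Tm R n) : Tm R n
  | caseOf {n : ℕ} (E : Tm R n) (E₁ E₂ : Tm R (n + 1)) : Tm R n
  | zero {n : ℕ} : Tm R n
  | succ {n : ℕ} (E : Tm R n) : Tm R n
  | nrec {n : ℕ} (E E₁ E₂ : Tm R n) : Tm R n
  | nil {n : ℕ} : Tm R n
  | cons {n : ℕ} (E₁ E₂ : Tm R n) : Tm R n
  | lrec {n : ℕ} (E E₁ E₂ : Tm R n) : Tm R n

namespace Tm

/-- Extension of a renaming under a binder. -/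
def up {n m : ℕ} (ρ : Fin n → Fin m) : Fin (n + 1) → Fin (m + 1) :=
  Matrix.vecCons 0 (fun i => (ρ i).succ)

def rename {R : Type*} : {n m : ℕ} → (Fin n → Fin m) → Tm R n → Tm R m
  | _, _, ρ, var i => var (ρ i)
  | _, _, _, const c => const c
  | _, _, ρ, plus E₁ E₂ => plus (rename ρ E₁) (rename ρ E₂)
  | _, _, ρ, times k E => times k (rename ρ E)
  | _, _, ρ, lam E => lam (rename (up ρ) E)
  | _, _, ρ, app E₁ E₂ => app (rename ρ E₁) (rename ρ E₂)
  | _, _, _, triv => triv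
  | _, _, ρ, pair E₁ E₂ => pair (rename ρ E₁) (rename ρ E₂)
  | _, _, ρ, fst E => fst (rename ρ E)
  | _, _, ρ, snd E => snd (rename ρ E)
  | _, _, ρ, inl E => inl (rename ρ E)
  | _, _, ρ, inr E => inr (rename ρ E)
  | _, _, ρ, caseOf E E₁ E₂ => caseOf (rename ρ E) (rename (up ρ) E₁) (rename (up ρ) E₂)
  | _, _, _, zero => zero
  | _, _, ρ, succ E => succ (rename ρ E)
  | _, _, ρ, nrec E E₁ E₂ => nrec (rename ρ E) (rename ρ E₁) (rename ρ E₂)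
  | _, _, _, nil => nil
  | _, _, ρ, cons E₁ E₂ => cons (rename ρ E₁) (rename ρ E₂)
  | _, _, ρ, lrec E E₁ E₂ => lrec (rename ρ E) (rename ρ E₁) (rename ρ E₂)

/-- The term, seen in a context with one more (unused) variable. -/
def weaken {R : Type*} {n : ℕ} (E : Tm R n) : Tm R (n + 1) := rename Fin.succ E

/-- Extension of a substitution under a binder. -/
def lift {R : Type*} {n m : ℕ} (σ : Fin n → Tm R m) : Fin (n + 1) → Tm R (m + 1) :=
  Matrix.vecCons (var 0) (fun i => weaken (σ i))

/-- Simultaneous capture-avoiding substitution. -/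
def subst {R : Type*} : {n m : ℕ} → (Fin n → Tm R m) → Tm R n → Tm R m
  | _, _, σ, var i => σ i
  | _, _, _, const c => const c
  | _, _, σ, plus E₁ E₂ => plus (subst σ E₁) (subst σ E₂)
  | _, _, σ, times k E => times k (subst σ E)
  | _, _, σ, lam E => lam (subst (lift σ) E)
  | _, _, σ, app E₁ E₂ => app (subst σ E₁) (subst σ E₂)
  | _, _, _, triv => triv
  | _, _, σ, pair E₁ E₂ => pair (subst σ E₁) (subst σ E₂)
  | _, _, σ, fst E => fst (subst σ E)
  | _, _, σ, snd E => snd (subst σ E)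
  | _, _, σ, inl E => inl (subst σ E)
  | _, _, σ, inr E => inr (subst σ E)
  | _, _, σ, caseOf E E₁ E₂ => caseOf (subst σ E) (subst (lift σ) E₁) (subst (lift σ) E₂)
  | _, _, _, zero => zero
  | _, _, σ, succ E => succ (subst σ E)
  | _, _, σ, nrec E E₁ E₂ => nrec (subst σ E) (subst σ E₁) (subst σ E₂)
  | _, _, _, nil => nil
  | _, _, σ, cons E₁ E₂ => cons (subst σ E₁) (subst σ E₂)
  | _, _, σ, lrec E E₁ E₂ => lrec (subst σ E) (subst σ E₁) (subst σ E₂)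

/-- `E[E'/x]` for the variable `x` of index `0`. -/
def subst1 {R : Type*} {n : ℕ} (E : Tm R (n + 1)) (E' : Tm R n) : Tm R n :=
  subst (Matrix.vecCons E' var) E

/-- `E[E₁/x, E₂/y]` for the variables `x` of index `1` and `y` of index `0`. -/
def subst2 {R : Type*} {n : ℕ} (E : Tm R (n + 2)) (E₁ E₂ : Tm R n) : Tm R n :=
  subst (Matrix.vecCons E₂ (Matrix.vecCons E₁ var)) E

/-- `E +_c E' = (E + π₁ E', π₂ E')`: the complexity `E'` with the cost `E` added to it. -/
def addCost {R : Type*} {n : ℕ} (E E' : Tm R n) : Tm R n :=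
  pair (plus E (fst E')) (snd E')

end Tm

/-- Contexts. -/
abbrev Ctx (n : ℕ) : Type := Fin n → Ty

/-- The context `Γ, x : T`, where `x` gets index `0`. -/
def Ctx.snoc {n : ℕ} (Γ : Ctx n) (T : Ty) : Ctx (n + 1) := Matrix.vecCons T Γ

/-- The typing judgment `Γ ⊢ E : T`. -/
inductive HasType {R : Type*} : {n : ℕ} → Ctx n → Tm R n → Ty → Prop
  | var {n : ℕ} {Γ : Ctx n} (i : Fin n) : HasType Γ (.var i) (Γ i)
  | const {n : ℕ} {Γ : Ctx n} (c : ExtCost R) : HasType Γ (.const c) .cost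
  | plus {n : ℕ} {Γ : Ctx n} {E₁ E₂ : Tm R n} :
      HasType Γ E₁ .cost → HasType Γ E₂ .cost → HasType Γ (.plus E₁ E₂) .cost
  | times {n : ℕ} {Γ : Ctx n} {k : Mult} {E : Tm R n} :
      HasType Γ E .cost → HasType Γ (.times k E) .cost
  | lam {n : ℕ} {Γ : Ctx n} {E : Tm R (n + 1)} {T₁ T₂ : Ty} :
      HasType (Γ.snoc T₁) E T₂ → HasType Γ (.lam E) (.arr T₁ T₂)
  | app {n : ℕ} {Γ : Ctx n} {E₁ E₂ : Tm R n} {T₁ T₂ : Ty} :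
      HasType Γ E₁ (.arr T₁ T₂) → HasType Γ E₂ T₁ → HasType Γ (.app E₁ E₂) T₂
  | triv {n : ℕ} {Γ : Ctx n} : HasType Γ .triv .one
  | pair {n : ℕ} {Γ : Ctx n} {E₁ E₂ : Tm R n} {T₁ T₂ : Ty} :
      HasType Γ E₁ T₁ → HasType Γ E₂ T₂ → HasType Γ (.pair E₁ E₂) (.prod T₁ T₂)
  | fst {n : ℕ} {Γ : Ctx n} {E : Tm R n} {T₁ T₂ : Ty} :
      HasType Γ E (.prod T₁ T₂) → HasType Γ (.fst E) T₁
  | snd {n : ℕ} {Γ : Ctx n} {E : Tm R n} {T₁ T₂ : Ty} :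
      HasType Γ E (.prod T₁ T₂) → HasType Γ (.snd E) T₂
  | inl {n : ℕ} {Γ : Ctx n} {E : Tm R n} {T₁ T₂ : Ty} :
      HasType Γ E T₁ → HasType Γ (.inl E) (.sum T₁ T₂)
  | inr {n : ℕ} {Γ : Ctx n} {E : Tm R n} {T₁ T₂ : Ty} :
      HasType Γ E T₂ → HasType Γ (.inr E) (.sum T₁ T₂)
  | caseOf {n : ℕ} {Γ : Ctx n} {E : Tm R n} {E₁ E₂ : Tm R (n + 1)} {T₁ T₂ T : Ty} :
      HasType Γ E (.sum T₁ T₂) → HasType (Γ.snoc T₁) E₁ T → HasType (Γ.snoc T₂) E₂ T →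
      HasType Γ (.caseOf E E₁ E₂) T
  | zero {n : ℕ} {Γ : Ctx n} : HasType Γ .zero .nat
  | succ {n : ℕ} {Γ : Ctx n} {E : Tm R n} : HasType Γ E .nat → HasType Γ (.succ E) .nat
  | nrec {n : ℕ} {Γ : Ctx n} {E E₁ E₂ : Tm R n} {T : Ty} :
      HasType Γ E .nat → HasType Γ E₁ (.arr .one T) →
      HasType Γ E₂ (.arr (.prod .nat T) T) → HasType Γ (.nrec E E₁ E₂) T
  | nil {n : ℕ} {Γ : Ctx n} {T : Ty} : HasType Γ .nil (.list T)
  | cons {n : ℕ} {Γ : Ctx n} {E₁ E₂ : Tm R n} {T : Ty} :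
      HasType Γ E₁ T → HasType Γ E₂ (.list T) → HasType Γ (.cons E₁ E₂) (.list T)
  | lrec {n : ℕ} {Γ : Ctx n} {E E₁ E₂ : Tm R n} {T₁ T : Ty} :
      HasType Γ E (.list T₁) → HasType Γ E₁ (.arr .one T) →
      HasType Γ E₂ (.arr (.prod T₁ (.prod (.list T₁) T)) T) → HasType Γ (.lrec E E₁ E₂) T

/-- The inequality judgment `Γ ⊢ E ≤_T E'`, a relation between terms of type `T` in context `Γ`:
a preorder; the arithmetic of costs; congruence in the principal positions of the elimination
forms; and every reduct is bounded by its redex. -/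
inductive Le {R : Type*} [CommRing R] [LinearOrder R] :
    {n : ℕ} → Ctx n → Ty → Tm R n → Tm R n → Prop
  | refl {n : ℕ} {Γ : Ctx n} {T : Ty} {E : Tm R n} : HasType Γ E T → Le Γ T E E
  | trans {n : ℕ} {Γ : Ctx n} {T : Ty} {E₁ E₂ E₃ : Tm R n} :
      Le Γ T E₁ E₂ → Le Γ T E₂ E₃ → Le Γ T E₁ E₃
  -- costs
  | const {n : ℕ} {Γ : Ctx n} {c d : ExtCost R} : c ≤ d → Le Γ .cost (.const c) (.const d)
  | constPlus {n : ℕ} {Γ : Ctx n} {c d : ExtCost R} :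
      Le Γ .cost (.const (c + d)) (.plus (.const c) (.const d))
  | plusConst {n : ℕ} {Γ : Ctx n} {c d : ExtCost R} :
      Le Γ .cost (.plus (.const c) (.const d)) (.const (c + d))
  | constTimes {n : ℕ} {Γ : Ctx n} {k : Mult} {c : ExtCost R} :
      Le Γ .cost (.const (ExtCost.scale k c)) (.times k (.const c))
  | timesConst {n : ℕ} {Γ : Ctx n} {k : Mult} {c : ExtCost R} :
      Le Γ .cost (.times k (.const c)) (.const (ExtCost.scale k c))
  | plusComm {n : ℕ} {Γ : Ctx n} {E₁ E₂ : Tm R n} :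
      HasType Γ E₁ .cost → HasType Γ E₂ .cost → Le Γ .cost (.plus E₁ E₂) (.plus E₂ E₁)
  | plusAssoc {n : ℕ} {Γ : Ctx n} {E₁ E₂ E₃ : Tm R n} :
      HasType Γ E₁ .cost → HasType Γ E₂ .cost → HasType Γ E₃ .cost →
      Le Γ .cost (.plus (.plus E₁ E₂) E₃) (.plus E₁ (.plus E₂ E₃))
  | zeroPlus {n : ℕ} {Γ : Ctx n} {E : Tm R n} :
      HasType Γ E .cost → Le Γ .cost (.plus (.const 0) E) E
  | plusZero {n : ℕ} {Γ : Ctx n} {E : Tm R n} :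
      HasType Γ E .cost → Le Γ .cost E (.plus (.const 0) E)
  | plus {n : ℕ} {Γ : Ctx n} {E₁ E₁' E₂ E₂' : Tm R n} :
      Le Γ .cost E₁ E₁' → Le Γ .cost E₂ E₂' → Le Γ .cost (.plus E₁ E₂) (.plus E₁' E₂')
  | times {n : ℕ} {Γ : Ctx n} {k : Mult} {E E' : Tm R n} :
      Le Γ .cost E E' → Le Γ .cost (.times k E) (.times k E')
  -- congruence
  | app {n : ℕ} {Γ : Ctx n} {T₁ T₂ : Ty} {E E' E₁ : Tm R n} :
      Le Γ (.arr T₁ T₂) E E' → HasType Γ E₁ T₁ → Le Γ T₂ (.app E E₁) (.app E' E₁)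
  | fst {n : ℕ} {Γ : Ctx n} {T₁ T₂ : Ty} {E E' : Tm R n} :
      Le Γ (.prod T₁ T₂) E E' → Le Γ T₁ (.fst E) (.fst E')
  | snd {n : ℕ} {Γ : Ctx n} {T₁ T₂ : Ty} {E E' : Tm R n} :
      Le Γ (.prod T₁ T₂) E E' → Le Γ T₂ (.snd E) (.snd E')
  | caseOf {n : ℕ} {Γ : Ctx n} {T₁ T₂ T : Ty} {E E' : Tm R n} {E₁ E₂ : Tm R (n + 1)} :
      Le Γ (.sum T₁ T₂) E E' → HasType (Γ.snoc T₁) E₁ T → HasType (Γ.snoc T₂) E₂ T →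
      Le Γ T (.caseOf E E₁ E₂) (.caseOf E' E₁ E₂)
  | nrec {n : ℕ} {Γ : Ctx n} {T : Ty} {E E' E₁ E₂ : Tm R n} :
      Le Γ .nat E E' → HasType Γ E₁ (.arr .one T) → HasType Γ E₂ (.arr (.prod .nat T) T) →
      Le Γ T (.nrec E E₁ E₂) (.nrec E' E₁ E₂)
  | lrec {n : ℕ} {Γ : Ctx n} {T₁ T : Ty} {E E' E₁ E₂ : Tm R n} :
      Le Γ (.list T₁) E E' → HasType Γ E₁ (.arr .one T) →
      HasType Γ E₂ (.arr (.prod T₁ (.prod (.list T₁) T)) T) →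
      Le Γ T (.lrec E E₁ E₂) (.lrec E' E₁ E₂)
  -- reduction
  | beta {n : ℕ} {Γ : Ctx n} {T₁ T₂ : Ty} {E : Tm R (n + 1)} {E' : Tm R n} :
      HasType (Γ.snoc T₁) E T₂ → HasType Γ E' T₁ → Le Γ T₂ (E.subst1 E') (.app (.lam E) E')
  | fstPair {n : ℕ} {Γ : Ctx n} {T₁ T₂ : Ty} {E₁ E₂ : Tm R n} :
      HasType Γ E₁ T₁ → HasType Γ E₂ T₂ → Le Γ T₁ E₁ (.fst (.pair E₁ E₂))
  | sndPair {n : ℕ} {Γ : Ctx n} {T₁ T₂ : Ty} {E₁ E₂ : Tm R n} :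
      HasType Γ E₁ T₁ → HasType Γ E₂ T₂ → Le Γ T₂ E₂ (.snd (.pair E₁ E₂))
  | caseInl {n : ℕ} {Γ : Ctx n} {T₁ T₂ T : Ty} {E : Tm R n} {E₁ E₂ : Tm R (n + 1)} :
      HasType Γ E T₁ → HasType (Γ.snoc T₁) E₁ T → HasType (Γ.snoc T₂) E₂ T →
      Le Γ T (E₁.subst1 E) (.caseOf (.inl E) E₁ E₂)
  | caseInr {n : ℕ} {Γ : Ctx n} {T₁ T₂ T : Ty} {E : Tm R n} {E₁ E₂ : Tm R (n + 1)} :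
      HasType Γ E T₂ → HasType (Γ.snoc T₁) E₁ T → HasType (Γ.snoc T₂) E₂ T →
      Le Γ T (E₂.subst1 E) (.caseOf (.inr E) E₁ E₂)
  | nrecZero {n : ℕ} {Γ : Ctx n} {T : Ty} {E₁ E₂ : Tm R n} :
      HasType Γ E₁ (.arr .one T) → HasType Γ E₂ (.arr (.prod .nat T) T) →
      Le Γ T (.app E₁ .triv) (.nrec .zero E₁ E₂)
  | nrecSucc {n : ℕ} {Γ : Ctx n} {T : Ty} {E E₁ E₂ : Tm R n} :
      HasType Γ E .nat → HasType Γ E₁ (.arr .one T) → HasType Γ E₂ (.arr (.prod .nat T) T) →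
      Le Γ T (.app E₂ (.pair E (.nrec E E₁ E₂))) (.nrec (.succ E) E₁ E₂)
  | lrecNil {n : ℕ} {Γ : Ctx n} {T₁ T : Ty} {E₁ E₂ : Tm R n} :
      HasType Γ E₁ (.arr .one T) → HasType Γ E₂ (.arr (.prod T₁ (.prod (.list T₁) T)) T) →
      Le Γ T (.app E₁ .triv) (.lrec .nil E₁ E₂)
  | lrecCons {n : ℕ} {Γ : Ctx n} {T₁ T : Ty} {E E' E₁ E₂ : Tm R n} :
      HasType Γ E T₁ → HasType Γ E' (.list T₁) → HasType Γ E₁ (.arr .one T) →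
      HasType Γ E₂ (.arr (.prod T₁ (.prod (.list T₁) T)) T) →
      Le Γ T (.app E₂ (.pair E (.pair E' (.lrec E' E₁ E₂)))) (.lrec (.cons E E') E₁ E₂)

end LamC

/-! # Recurrence extraction -/

namespace LamA

/-- The type of potentials of a type `A`. -/
def Ty.potential : Ty → LamC.Ty
  | .bang _ _ A => A.potential
  | .lolli A B => .arr A.potential (.prod .cost B.potential)
  | .tensor A B => .prod A.potential B.potential
  | .amp A B => .prod (.prod .cost A.potential) (.prod .cost B.potential)
  | .oplus A B => .sum A.potential B.potential
  | .one => .one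
  | .nat => .nat
  | .list A => .list A.potential

/-- The type of complexities of a type `A`. -/
def Ty.complexity (A : Ty) : LamC.Ty := .prod .cost A.potential

/-- The recurrence extracted from a term. -/
noncomputable def Tm.extract (R : Type*) [CommRing R] : {n : ℕ} → Tm n → LamC.Tm R n
  | _, .var i => .pair (.const 0) (.var i)
  | _, .tick M => .addCost (.const (ExtCost.fin 1)) (M.extract R)
  | _, .create l M => .addCost (.const (ExtCost.credit R l)) (M.extract R)
  | _, .spend l M => .addCost (.const (ExtCost.debit R l)) (M.extract R)
  | _, .save k _ M => .pair (.times k (.fst (M.extract R))) (.snd (M.extract R))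
  | _, .transfer j _ _ M N =>
      .addCost (.times j (.fst (M.extract R))) ((N.extract R).subst1 (.snd (M.extract R)))
  | _, .lam M => .pair (.const 0) (.lam (M.extract R))
  | _, .app M N =>
      .addCost (.plus (.fst (M.extract R)) (.fst (N.extract R)))
        (.app (.snd (M.extract R)) (.snd (N.extract R)))
  | _, .pair M N =>
      .pair (.plus (.fst (M.extract R)) (.fst (N.extract R)))
        (.pair (.snd (M.extract R)) (.snd (N.extract R)))
  | _, .letPair j M N =>
      .addCost (.times j (.fst (M.extract R)))
        ((N.extract R).subst2 (.fst (.snd (M.extract R))) (.snd (.snd (M.extract R))))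
  | _, .lazyPair M N => .pair (.const 0) (.pair (M.extract R) (N.extract R))
  | _, .fst M => .addCost (.fst (M.extract R)) (.fst (.snd (M.extract R)))
  | _, .snd M => .addCost (.fst (M.extract R)) (.snd (.snd (M.extract R)))
  | _, .inl M => .pair (.fst (M.extract R)) (.inl (.snd (M.extract R)))
  | _, .inr M => .pair (.fst (M.extract R)) (.inr (.snd (M.extract R)))
  | _, .caseOf j M N₁ N₂ =>
      .addCost (.times j (.fst (M.extract R)))
        (.caseOf (.snd (M.extract R)) (N₁.extract R) (N₂.extract R))
  | _, .triv => .pair (.const 0) .triv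
  | _, .zero => .pair (.const 0) .zero
  | _, .succ M => .pair (.fst (M.extract R)) (.succ (.snd (M.extract R)))
  -- the step function is `λ p. E₂ (π₁ p, λ z. π₂ p)` for the potential `E₂` of `N₂`
  | _, .nrec M N₁ N₂ =>
      .addCost (.plus (.plus (.fst (M.extract R)) (.fst (N₁.extract R))) (.fst (N₂.extract R)))
        (.nrec (.snd (M.extract R)) (.snd (N₁.extract R))
          (.lam (.app (LamC.Tm.weaken (.snd (N₂.extract R)))
            (.pair (.fst (.var 0)) (.lam (.snd (.var 1)))))))
  | _, .nil => .pair (.const 0) .nil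
  | _, .cons M N =>
      .pair (.plus (.fst (M.extract R)) (.fst (N.extract R)))
        (.cons (.snd (M.extract R)) (.snd (N.extract R)))
  -- the step function is `λ p. E₂ (π₁ p, ((0, π₁ (π₂ p)), π₂ (π₂ p)))`
  | _, .lrec M N₁ N₂ =>
      .addCost (.plus (.plus (.fst (M.extract R)) (.fst (N₁.extract R))) (.fst (N₂.extract R)))
        (.lrec (.snd (M.extract R)) (.snd (N₁.extract R))
          (.lam (.app (LamC.Tm.weaken (.snd (N₂.extract R)))
            (.pair (.fst (.var 0))
              (.pair (.pair (.const 0) (.fst (.snd (.var 0)))) (.snd (.snd (.var 0))))))))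

end LamA

/-!
The ticks of an evaluation are bounded by amortization: for a term `M` that owns `a` credits and
`M ↓^(n, r) v`, the amortized cost `n + r` is bounded by the cost component of the extracted
recurrence, and the credits `a + r` are enough for those that are stored in `v`.  As a number of
credits is nonnegative, `a = 0` gives `0 ≤ r`, hence `n ≤ n + r`.

Both claims are proved at once, by a logical relation `LamA.ValBound A a v E` between values `v`
of type `A` that store at most `a` credits and closed potentials `E` of the recurrence language,
defined by recursion on `A`.  It is extended to terms and complexities by `LamA.TermBound`.  It is
closed under adding credits and under increasing `E` in the inequality judgment
(`LamA.ValBound.mono`); therefore the elimination forms alone have to be monotone, and every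
reduction step on the side of the recurrences is absorbed by the inequality.  As credits are part
of the relation, no typing of the values of `λ^A`, and so no substitution lemma for its resource
terms, is needed.

The fundamental theorem `LamA.HasType.termBound` is an induction on the typing derivation in which
the variables are replaced by related values, a variable `i` with `a i` credits, so that a resource
term becomes the number `LamA.Res.eval` of credits.  Each term former has a compatibility lemma.
Two facts about extended costs make the multiplicities work: `n + k r ≤ k (n + r)` for `k ≥ 1`
(`ExtCost.amort_scale_le`), since ticks are not multiplied in an evaluation but are in the
recurrence; and `b ≤ a + r` implies `k b ≤ k a + k r` (`ExtCost.credit_mul_le`).  Recursors need an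
induction on the number or list (`LamA.NatBound.nrec`, `LamA.ListBound.lrec`); the suspended
recursive call is related to its recurrence by the induction hypothesis, and the unrestricted use
of the step function is paid for by its multiplicity `∞`, as `c + ∞ c = ∞ c`.
-/

/-! ### Arithmetic of extended costs -/

namespace ExtCost

theorem negInfty_le {R : Type*} [LinearOrder R] (x : ExtCost R) : negInfty ≤ x :=
  (bot_le : (⊥ : ExtCost R) ≤ x)

theorem fin_le_fin {R : Type*} [LinearOrder R] {a b : R} : fin a ≤ fin b ↔ a ≤ b :=
  WithTop.coe_le_coe.trans WithBot.coe_le_coe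

section Ring

variable {R : Type*} [CommRing R]

theorem fin_zero : fin (0 : R) = 0 := rfl

theorem fin_add (a b : R) : fin (a + b) = fin a + fin b := rfl

theorem negInfty_add_fin (a : R) : negInfty + fin a = negInfty :=
  congrArg WithTop.some (WithBot.bot_add _)

theorem credit_natCast (m : ℕ) : credit R (m : ℕ∞) = fin (m : R) := by
  simp [credit]

theorem credit_top : credit R ⊤ = ⊤ := by
  simp [credit]

theorem credit_zero : credit R 0 = 0 := by
  simpa [fin_zero] using credit_natCast (R := R) 0

theorem credit_add (a b : ℕ∞) : credit R (a + b) = credit R a + credit R b := by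
  induction a with
  | top => simp [credit_top]
  | coe a =>
    induction b with
    | top => simp [credit_top]
    | coe b => rw [← Nat.cast_add, credit_natCast, credit_natCast, credit_natCast, ← fin_add,
        Nat.cast_add]

variable (R) in
/-- The map of extended costs that is induced by `ℤ → R`. -/
def ofInt : ExtCost ℤ →+ ExtCost R := (Int.castAddHom R).withBotMap.withTopMap

theorem ofInt_top : ofInt R ⊤ = ⊤ := rfl

theorem ofInt_negInfty : ofInt R negInfty = negInfty := rfl

theorem ofInt_fin (a : ℤ) : ofInt R (fin a) = fin (a : R) := rfl

theorem ofInt_credit (l : ℕ∞) : ofInt R (credit ℤ l) = credit R l := by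
  unfold credit; split_ifs
  · rfl
  · rw [ofInt_fin, Int.cast_natCast]

theorem ofInt_debit (l : ℕ∞) : ofInt R (debit ℤ l) = debit R l := by
  unfold debit; split_ifs
  · rfl
  · rw [ofInt_fin, Int.cast_neg, Int.cast_natCast]

variable (R) in
/-- The amortized cost `n + r` of an evaluation with `n` ticks and credit balance `r`. -/
def amort (n : ℕ) (r : Balance) : ExtCost R := fin (n : R) + ofInt R r

theorem amort_zero : amort R 0 0 = 0 := by
  simp [amort, fin_zero]

theorem amort_add (n m : ℕ) (r s : Balance) :
    amort R (n + m) (r + s) = amort R n r + amort R m s := by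
  simp only [amort, Nat.cast_add, fin_add, map_add]
  exact add_add_add_comm _ _ _ _

end Ring

section Order

variable {R : Type*} [CommRing R] [LinearOrder R]

theorem _root_.Mult.eq_top_or_nat (k : Mult) :
    k.1 = ⊤ ∨ ∃ m : ℕ, k.1 = ((m + 1 : ℕ) : ℕ∞) := by
  obtain ⟨k, hk⟩ := k
  induction k with
  | top => exact .inl rfl
  | coe m =>
    have hm : 1 ≤ m := by exact_mod_cast hk
    exact .inr ⟨m - 1, by simp only [Nat.sub_add_cancel hm]⟩

theorem scale_of_nat {k : Mult} {m : ℕ} (h : k.1 = (m : ℕ∞)) (x : ExtCost R) :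
    scale k x = m • x := by
  simp [scale, h]

theorem scale_of_pos {k : Mult} (h : k.1 = ⊤) {x : ExtCost R} (hx : 0 < x) : scale k x = ⊤ := by
  simp [scale, h, hx, hx.ne']

theorem scale_of_neg {k : Mult} (h : k.1 = ⊤) {x : ExtCost R} (hx : x < 0) :
    scale k x = negInfty := by
  simp [scale, h, hx.ne, hx.not_gt]

theorem scale_zero (k : Mult) : scale k (0 : ExtCost R) = 0 := by
  unfold scale; split_ifs <;> simp_all

/-- Spending `l` credits takes them from the account; if `l = ∞`, the account stays infinite. -/
theorem credit_le_credit_add_debit (a l : ℕ∞) :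
    credit R a ≤ credit R (a + l) + debit R l := by
  rw [credit_add]
  by_cases hl : l = ⊤
  · subst hl; simp [credit_top]
  · lift l to ℕ using hl
    rw [credit_natCast, add_assoc]
    simp [debit, ← fin_add, fin_zero]

end Order

section Scale

variable {R : Type*} [CommRing R] [LinearOrder R] [IsStrictOrderedRing R]

theorem fin_natCast_nonneg (n : ℕ) : 0 ≤ fin (n : R) :=
  fin_le_fin.2 (Nat.cast_nonneg n)

theorem scale_mono (k : Mult) {x y : ExtCost R} (h : x ≤ y) : scale k x ≤ scale k y := by
  obtain hk | ⟨m, hm⟩ := k.eq_top_or_nat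
  · rcases lt_trichotomy x 0 with hx | rfl | hx
    · rw [scale_of_neg hk hx]; exact negInfty_le _
    · rcases h.eq_or_lt with rfl | hy
      · exact le_rfl
      · rw [scale_of_pos hk hy]; exact le_top
    · rw [scale_of_pos hk (hx.trans_le h)]; exact le_top
  · rw [scale_of_nat hm, scale_of_nat hm]; exact nsmul_le_nsmul_right h _

theorem scale_add_le (k : Mult) (x y : ExtCost R) :
    scale k (x + y) ≤ scale k x + scale k y := by
  obtain hk | ⟨m, hm⟩ := k.eq_top_or_nat
  · rcases lt_or_ge 0 x with hx | hx
    · rw [scale_of_pos hk hx, WithTop.top_add]; exact le_top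
    rcases lt_or_ge 0 y with hy | hy
    · rw [scale_of_pos hk hy, WithTop.add_top]; exact le_top
    rcases hx.eq_or_lt with rfl | hx'
    · rw [zero_add, scale_zero, zero_add]
    · rw [scale_of_neg hk ((add_le_of_nonpos_right hy).trans_lt hx')]; exact negInfty_le _
  · simp only [scale_of_nat hm, nsmul_add, le_refl]

/-- Ticks may be counted once or `k` times: the latter only increases the bound, as `k ≥ 1`. -/
theorem add_scale_le (k : Mult) (n : ℕ) (x : ExtCost R) :
    fin (n : R) + scale k x ≤ scale k (fin (n : R) + x) := by
  have hn := fin_natCast_nonneg (R := R) n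
  obtain hk | ⟨m, hm⟩ := k.eq_top_or_nat
  · rcases lt_or_ge x 0 with hx | hx
    · rw [scale_of_neg hk hx, add_comm, negInfty_add_fin]; exact negInfty_le _
    rcases (add_nonneg hn hx).eq_or_lt with h | h
    · have hx0 : x = 0 := le_antisymm (h ▸ le_add_of_nonneg_left hn) hx
      subst hx0
      rw [← h, scale_zero, add_zero]
      rw [add_zero] at h
      exact h.ge
    · rw [scale_of_pos hk h]; exact le_top
  · simp only [scale_of_nat hm, nsmul_add]
    gcongr
    rw [succ_nsmul]
    exact le_add_of_nonneg_left (nsmul_nonneg hn _)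

theorem credit_nonneg (a : ℕ∞) : 0 ≤ credit R a := by
  induction a with
  | top => simp [credit_top]
  | coe a => rw [credit_natCast]; exact fin_natCast_nonneg a

theorem credit_mono {a b : ℕ∞} (h : a ≤ b) : credit R a ≤ credit R b := by
  obtain ⟨c, rfl⟩ := exists_add_of_le h
  rw [credit_add]
  exact le_add_of_nonneg_right (credit_nonneg c)

theorem scale_credit (k : Mult) (a : ℕ∞) : scale k (credit R a) = credit R (k.1 * a) := by
  obtain hk | ⟨m, hm⟩ := k.eq_top_or_nat
  · rcases eq_or_ne a 0 with rfl | ha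
    · simp [credit_zero, scale_zero]
    · have : 0 < credit R a := by
        refine lt_of_lt_of_le ?_ (credit_mono (Order.one_le_iff_ne_zero.2 ha))
        rw [← Nat.cast_one, credit_natCast, ← fin_zero]
        exact lt_of_le_not_ge (fin_le_fin.2 (by simp)) fun h =>
          absurd (fin_le_fin.1 h) (by simp)
      rw [scale_of_pos hk this, hk, ENat.top_mul ha, credit_top]
  · rw [scale_of_nat hm, hm]
    generalize m + 1 = m
    induction m with
    | zero => simp [credit_zero]
    | succ m ih => rw [succ_nsmul, ih, Nat.cast_succ, add_mul, one_mul, credit_add]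

theorem ofInt_strictMono : StrictMono (ofInt R) :=
  (Int.cast_strictMono.withBot_map).withTop_map

theorem ofInt_scale (k : Mult) (x : ExtCost ℤ) : ofInt R (scale k x) = scale k (ofInt R x) := by
  obtain hk | ⟨m, hm⟩ := k.eq_top_or_nat
  · rcases lt_trichotomy x 0 with hx | rfl | hx
    · have := ofInt_strictMono (R := R) hx
      rw [map_zero] at this
      rw [scale_of_neg hk hx, scale_of_neg hk this, ofInt_negInfty]
    · simp only [map_zero, scale_zero]
    · have := ofInt_strictMono (R := R) hx
      rw [map_zero] at this
      rw [scale_of_pos hk hx, scale_of_pos hk this, ofInt_top]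
  · rw [scale_of_nat hm, scale_of_nat hm, map_nsmul]

theorem amort_scale_le (k : Mult) (n : ℕ) (r : Balance) :
    amort R n (scale k r) ≤ scale k (amort R n r) := by
  rw [amort, ofInt_scale]; exact add_scale_le k n _

theorem credit_mul_le {k : Mult} {a b : ℕ∞} {r : Balance} (h : credit ℤ b ≤ credit ℤ a + r) :
    credit ℤ (k.1 * b) ≤ credit ℤ (k.1 * a) + scale k r := by
  rw [← scale_credit, ← scale_credit]
  exact (scale_mono k h).trans (scale_add_le k _ _)

end Scale
end ExtCost

/-! ### Substitution in the affine language -/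

namespace LamA.Tm

theorem up_comp {n m p : ℕ} (ρ : Fin n → Fin m) (ρ' : Fin m → Fin p) (i : Fin (n + 1)) :
    up ρ' (up ρ i) = up (fun i => ρ' (ρ i)) i := by
  refine Fin.cases ?_ (fun i => ?_) i <;> rfl

theorem rename_rename {n m p : ℕ} (ρ : Fin n → Fin m) (ρ' : Fin m → Fin p) (M : Tm n) :
    rename ρ' (rename ρ M) = rename (fun i => ρ' (ρ i)) M := by
  induction M generalizing m p <;> simp only [rename, up_comp, *]

theorem lift_up {n m p : ℕ} (ρ : Fin n → Fin m) (σ : Fin m → Tm p) (i : Fin (n + 1)) :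
    lift σ (up ρ i) = lift (fun i => σ (ρ i)) i := by
  refine Fin.cases ?_ (fun i => ?_) i <;> rfl

theorem subst_rename {n m p : ℕ} (ρ : Fin n → Fin m) (σ : Fin m → Tm p) (M : Tm n) :
    subst σ (rename ρ M) = subst (fun i => σ (ρ i)) M := by
  induction M generalizing m p <;> simp only [rename, subst, lift_up, *]

theorem rename_lift {n m p : ℕ} (σ : Fin n → Tm m) (ρ : Fin m → Fin p) (i : Fin (n + 1)) :
    rename (up ρ) (lift σ i) = lift (fun i => rename ρ (σ i)) i := by
  refine Fin.cases rfl (fun i => ?_) i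
  change rename (up ρ) (rename Fin.succ (σ i)) = rename Fin.succ (rename ρ (σ i))
  rw [rename_rename, rename_rename]
  rfl

theorem rename_subst {n m p : ℕ} (σ : Fin n → Tm m) (ρ : Fin m → Fin p) (M : Tm n) :
    rename ρ (subst σ M) = subst (fun i => rename ρ (σ i)) M := by
  induction M generalizing m p <;> simp only [rename, subst, rename_lift, *]

theorem subst_lift {n m p : ℕ} (σ : Fin n → Tm m) (τ : Fin m → Tm p) (i : Fin (n + 1)) :
    subst (lift τ) (lift σ i) = lift (fun i => subst τ (σ i)) i := by
  refine Fin.cases rfl (fun i => ?_) i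
  exact (subst_rename _ _ _).trans (rename_subst _ _ _).symm

theorem subst_subst {n m p : ℕ} (σ : Fin n → Tm m) (τ : Fin m → Tm p) (M : Tm n) :
    subst τ (subst σ M) = subst (fun i => subst τ (σ i)) M := by
  induction M generalizing m p <;> simp only [subst, subst_lift, *]

theorem lift_var {n : ℕ} : lift (var : Fin n → Tm n) = var := by
  funext i; refine Fin.cases ?_ (fun i => ?_) i <;> rfl

theorem subst_var {n : ℕ} (M : Tm n) : subst var M = M := by
  induction M <;> simp only [subst, lift_var, *]

theorem weaken_subst1 {n : ℕ} (M N : Tm n) : M.weaken.subst1 N = M :=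
  (subst_rename _ _ _).trans (subst_var M)

theorem subst_vecCons_weaken {n m : ℕ} (N : Tm m) (σ : Fin n → Tm m) (M : Tm n) :
    subst (Matrix.vecCons N σ) M.weaken = subst σ M :=
  subst_rename _ _ _

theorem subst_lift_subst1 {n m : ℕ} (σ : Fin n → Tm m) (M : Tm (n + 1)) (N : Tm m) :
    (subst (lift σ) M).subst1 N = subst (Matrix.vecCons N σ) M := by
  refine (subst_subst _ _ _).trans (congrArg (subst · M) ?_)
  funext i
  exact Fin.cases rfl (fun i => weaken_subst1 _ _) i

theorem subst_lift_subst2 {n m : ℕ} (σ : Fin n → Tm m) (M : Tm (n + 2)) (N₁ N₂ : Tm m) :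
    (subst (lift (lift σ)) M).subst2 N₁ N₂ =
      subst (Matrix.vecCons N₂ (Matrix.vecCons N₁ σ)) M := by
  refine (subst_subst _ _ _).trans (congrArg (subst · M) ?_)
  funext i
  refine Fin.cases rfl (fun i => ?_) i
  refine Fin.cases rfl (fun i => ?_) i
  exact (subst_vecCons_weaken _ _ _).trans (weaken_subst1 _ _)

end LamA.Tm

/-! ### Substitution and typing in the recurrence language -/

namespace LamC

variable {R : Type*}

namespace Tm

theorem up_comp {n m p : ℕ} (ρ : Fin n → Fin m) (ρ' : Fin m → Fin p) (i : Fin (n + 1)) :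
    up ρ' (up ρ i) = up (fun i => ρ' (ρ i)) i := by
  refine Fin.cases ?_ (fun i => ?_) i <;> rfl

theorem rename_rename {n m p : ℕ} (ρ : Fin n → Fin m) (ρ' : Fin m → Fin p) (E : Tm R n) :
    rename ρ' (rename ρ E) = rename (fun i => ρ' (ρ i)) E := by
  induction E generalizing m p <;> simp only [rename, up_comp, *]

theorem lift_up {n m p : ℕ} (ρ : Fin n → Fin m) (θ : Fin m → Tm R p) (i : Fin (n + 1)) :
    lift θ (up ρ i) = lift (fun i => θ (ρ i)) i := by
  refine Fin.cases ?_ (fun i => ?_) i <;> rfl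

theorem subst_rename {n m p : ℕ} (ρ : Fin n → Fin m) (θ : Fin m → Tm R p) (E : Tm R n) :
    subst θ (rename ρ E) = subst (fun i => θ (ρ i)) E := by
  induction E generalizing m p <;> simp only [rename, subst, lift_up, *]

theorem rename_lift {n m p : ℕ} (θ : Fin n → Tm R m) (ρ : Fin m → Fin p) (i : Fin (n + 1)) :
    rename (up ρ) (lift θ i) = lift (fun i => rename ρ (θ i)) i := by
  refine Fin.cases rfl (fun i => ?_) i
  change rename (up ρ) (rename Fin.succ (θ i)) = rename Fin.succ (rename ρ (θ i))
  rw [rename_rename, rename_rename]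
  rfl

theorem rename_subst {n m p : ℕ} (θ : Fin n → Tm R m) (ρ : Fin m → Fin p) (E : Tm R n) :
    rename ρ (subst θ E) = subst (fun i => rename ρ (θ i)) E := by
  induction E generalizing m p <;> simp only [rename, subst, rename_lift, *]

theorem subst_lift {n m p : ℕ} (θ : Fin n → Tm R m) (η : Fin m → Tm R p) (i : Fin (n + 1)) :
    subst (lift η) (lift θ i) = lift (fun i => subst η (θ i)) i := by
  refine Fin.cases rfl (fun i => ?_) i
  exact (subst_rename _ _ _).trans (rename_subst _ _ _).symm

theorem subst_subst {n m p : ℕ} (θ : Fin n → Tm R m) (η : Fin m → Tm R p) (E : Tm R n) :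
    subst η (subst θ E) = subst (fun i => subst η (θ i)) E := by
  induction E generalizing m p <;> simp only [subst, subst_lift, *]

theorem lift_var {n : ℕ} : lift (var : Fin n → Tm R n) = var := by
  funext i; refine Fin.cases ?_ (fun i => ?_) i <;> rfl

theorem subst_var {n : ℕ} (E : Tm R n) : subst var E = E := by
  induction E <;> simp only [subst, lift_var, *]

theorem weaken_subst1 {n : ℕ} (E E' : Tm R n) : E.weaken.subst1 E' = E :=
  (subst_rename _ _ _).trans (subst_var E)

theorem subst_lift_weaken {n m : ℕ} (θ : Fin n → Tm R m) (E : Tm R n) :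
    subst (lift θ) E.weaken = (subst θ E).weaken :=
  (subst_rename _ _ _).trans (rename_subst _ _ _).symm

theorem subst_lift_subst1 {n m : ℕ} (θ : Fin n → Tm R m) (E : Tm R (n + 1)) (E' : Tm R m) :
    (subst (lift θ) E).subst1 E' = subst (Matrix.vecCons E' θ) E := by
  refine (subst_subst _ _ _).trans (congrArg (subst · E) ?_)
  funext i
  exact Fin.cases rfl (fun i => weaken_subst1 _ _) i

theorem subst_subst1 {n m : ℕ} (θ : Fin n → Tm R m) (E : Tm R (n + 1)) (E' : Tm R n) :
    subst θ (E.subst1 E') = subst (Matrix.vecCons (subst θ E') θ) E := by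
  refine (subst_subst _ _ _).trans (congrArg (subst · E) ?_)
  funext i
  exact Fin.cases rfl (fun i => rfl) i

theorem subst_subst2 {n m : ℕ} (θ : Fin n → Tm R m) (E : Tm R (n + 2)) (E₁ E₂ : Tm R n) :
    subst θ (E.subst2 E₁ E₂) =
      subst (Matrix.vecCons (subst θ E₂) (Matrix.vecCons (subst θ E₁) θ)) E := by
  refine (subst_subst _ _ _).trans (congrArg (subst · E) ?_)
  funext i
  refine Fin.cases rfl (fun i => ?_) i
  exact Fin.cases rfl (fun i => rfl) i

end Tm

theorem up_snoc {n m : ℕ} {Γ : Ctx n} {Δ : Ctx m} {ρ : Fin n → Fin m}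
    (hρ : ∀ i, Δ (ρ i) = Γ i) (T : Ty) (i : Fin (n + 1)) :
    Δ.snoc T (Tm.up ρ i) = Γ.snoc T i :=
  Fin.cases rfl (fun i => hρ i) i

theorem HasType.rename {n : ℕ} {Γ : Ctx n} {E : Tm R n} {T : Ty} (h : HasType Γ E T) :
    ∀ {m : ℕ} {Δ : Ctx m} {ρ : Fin n → Fin m}, (∀ i, Δ (ρ i) = Γ i) →
      HasType Δ (E.rename ρ) T := by
  induction h with
  | var i => intro m Δ ρ hρ; exact hρ i ▸ .var (ρ i)
  | const c => intro m Δ ρ hρ; exact .const c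
  | plus _ _ h₁ h₂ => intro m Δ ρ hρ; exact .plus (h₁ hρ) (h₂ hρ)
  | times _ h => intro m Δ ρ hρ; exact .times (h hρ)
  | lam _ h => intro m Δ ρ hρ; exact .lam (h (up_snoc hρ _))
  | app _ _ h₁ h₂ => intro m Δ ρ hρ; exact .app (h₁ hρ) (h₂ hρ)
  | triv => intro m Δ ρ hρ; exact .triv
  | pair _ _ h₁ h₂ => intro m Δ ρ hρ; exact .pair (h₁ hρ) (h₂ hρ)
  | fst _ h => intro m Δ ρ hρ; exact .fst (h hρ)
  | snd _ h => intro m Δ ρ hρ; exact .snd (h hρ)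
  | inl _ h => intro m Δ ρ hρ; exact .inl (h hρ)
  | inr _ h => intro m Δ ρ hρ; exact .inr (h hρ)
  | caseOf _ _ _ h h₁ h₂ =>
    intro m Δ ρ hρ; exact .caseOf (h hρ) (h₁ (up_snoc hρ _)) (h₂ (up_snoc hρ _))
  | zero => intro m Δ ρ hρ; exact .zero
  | succ _ h => intro m Δ ρ hρ; exact .succ (h hρ)
  | nrec _ _ _ h h₁ h₂ => intro m Δ ρ hρ; exact .nrec (h hρ) (h₁ hρ) (h₂ hρ)
  | nil => intro m Δ ρ hρ; exact .nil
  | cons _ _ h₁ h₂ => intro m Δ ρ hρ; exact .cons (h₁ hρ) (h₂ hρ)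
  | lrec _ _ _ h h₁ h₂ => intro m Δ ρ hρ; exact .lrec (h hρ) (h₁ hρ) (h₂ hρ)

theorem HasType.weaken {n : ℕ} {Γ : Ctx n} {E : Tm R n} {T : Ty} (h : HasType Γ E T) (T' : Ty) :
    HasType (Γ.snoc T') E.weaken T :=
  h.rename fun _ => rfl

theorem HasType.vecCons {n m : ℕ} {Γ : Ctx n} {Δ : Ctx m} {θ : Fin n → Tm R m}
    (hθ : ∀ i, HasType Δ (θ i) (Γ i)) {T : Ty} {E : Tm R m} (h : HasType Δ E T)
    (i : Fin (n + 1)) : HasType Δ (Matrix.vecCons E θ i : Tm R m) (Γ.snoc T i) :=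
  Fin.cases h (fun i => hθ i) i

theorem HasType.lift {n m : ℕ} {Γ : Ctx n} {Δ : Ctx m} {θ : Fin n → Tm R m}
    (hθ : ∀ i, HasType Δ (θ i) (Γ i)) (T : Ty) (i : Fin (n + 1)) :
    HasType (Δ.snoc T) (Tm.lift θ i) (Γ.snoc T i) :=
  vecCons (fun i => (hθ i).weaken T) (.var 0) i

theorem HasType.subst {n : ℕ} {Γ : Ctx n} {E : Tm R n} {T : Ty} (h : HasType Γ E T) :
    ∀ {m : ℕ} {Δ : Ctx m} {θ : Fin n → Tm R m}, (∀ i, HasType Δ (θ i) (Γ i)) →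
      HasType Δ (E.subst θ) T := by
  induction h with
  | var i => intro m Δ θ hθ; exact hθ i
  | const c => intro m Δ θ hθ; exact .const c
  | plus _ _ h₁ h₂ => intro m Δ θ hθ; exact .plus (h₁ hθ) (h₂ hθ)
  | times _ h => intro m Δ θ hθ; exact .times (h hθ)
  | lam _ h => intro m Δ θ hθ; exact .lam (h (HasType.lift hθ _))
  | app _ _ h₁ h₂ => intro m Δ θ hθ; exact .app (h₁ hθ) (h₂ hθ)
  | triv => intro m Δ θ hθ; exact .triv
  | pair _ _ h₁ h₂ => intro m Δ θ hθ; exact .pair (h₁ hθ) (h₂ hθ)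
  | fst _ h => intro m Δ θ hθ; exact .fst (h hθ)
  | snd _ h => intro m Δ θ hθ; exact .snd (h hθ)
  | inl _ h => intro m Δ θ hθ; exact .inl (h hθ)
  | inr _ h => intro m Δ θ hθ; exact .inr (h hθ)
  | caseOf _ _ _ h h₁ h₂ =>
    intro m Δ θ hθ
    exact .caseOf (h hθ) (h₁ (HasType.lift hθ _)) (h₂ (HasType.lift hθ _))
  | zero => intro m Δ θ hθ; exact .zero
  | succ _ h => intro m Δ θ hθ; exact .succ (h hθ)
  | nrec _ _ _ h h₁ h₂ => intro m Δ θ hθ; exact .nrec (h hθ) (h₁ hθ) (h₂ hθ)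
  | nil => intro m Δ θ hθ; exact .nil
  | cons _ _ h₁ h₂ => intro m Δ θ hθ; exact .cons (h₁ hθ) (h₂ hθ)
  | lrec _ _ _ h h₁ h₂ => intro m Δ θ hθ; exact .lrec (h hθ) (h₁ hθ) (h₂ hθ)

theorem HasType.subst1 {n : ℕ} {Γ : Ctx n} {E : Tm R (n + 1)} {E' : Tm R n} {T T' : Ty}
    (h : HasType (Γ.snoc T') E T) (h' : HasType Γ E' T') : HasType Γ (E.subst1 E') T :=
  h.subst (HasType.vecCons (fun i => .var i) h')

theorem HasType.addCost {n : ℕ} {Γ : Ctx n} {E E' : Tm R n} {T : Ty}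
    (h : HasType Γ E .cost) (h' : HasType Γ E' (.prod .cost T)) :
    HasType Γ (Tm.addCost E E') (.prod .cost T) :=
  .pair (.plus h (.fst h')) (.snd h')

end LamC

/-! ### Values -/

namespace LamA

open ExtCost (amort credit)

/-- Values: the terms that evaluate to themselves. -/
inductive IsValue : Tm 0 → Prop
  | save {k : Mult} {l : ℕ∞} {v : Tm 0} : IsValue v → IsValue (.save k l v)
  | lam {M : Tm 1} : IsValue (.lam M)
  | pair {v w : Tm 0} : IsValue v → IsValue w → IsValue (.pair v w)
  | lazyPair {M N : Tm 0} : IsValue (.lazyPair M N)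
  | inl {v : Tm 0} : IsValue v → IsValue (.inl v)
  | inr {v : Tm 0} : IsValue v → IsValue (.inr v)
  | triv : IsValue .triv
  | zero : IsValue .zero
  | succ {v : Tm 0} : IsValue v → IsValue (.succ v)
  | nil : IsValue .nil
  | cons {v w : Tm 0} : IsValue v → IsValue w → IsValue (.cons v w)

theorem IsValue.eval {v : Tm 0} (h : IsValue v) : Eval v 0 0 v := by
  induction h with
  | @save k _ _ _ ih => simpa only [ExtCost.scale_zero] using Eval.save (k := k) ih
  | lam => exact .lam
  | pair _ _ h₁ h₂ => simpa only [add_zero] using Eval.pair h₁ h₂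
  | lazyPair => exact .lazyPair
  | inl _ ih => exact .inl ih
  | inr _ ih => exact .inr ih
  | triv => exact .triv
  | zero => exact .zero
  | succ _ ih => exact .succ ih
  | nil => exact .nil
  | cons _ _ h₁ h₂ => simpa only [add_zero] using Eval.cons h₁ h₂

theorem IsValue.eq_of_eval {v : Tm 0} (h : IsValue v) {n : ℕ} {r : Balance} {w : Tm 0}
    (hw : Eval v n r w) : n = 0 ∧ r = 0 ∧ w = v := by
  induction h generalizing n r w with
  | save _ ih =>
    cases hw with
    | save h => obtain ⟨rfl, rfl, rfl⟩ := ih h; exact ⟨rfl, ExtCost.scale_zero _, rfl⟩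
  | lam => cases hw; exact ⟨rfl, rfl, rfl⟩
  | pair _ _ ih₁ ih₂ =>
    cases hw with
    | pair h₁ h₂ =>
      obtain ⟨rfl, rfl, rfl⟩ := ih₁ h₁
      obtain ⟨rfl, rfl, rfl⟩ := ih₂ h₂
      exact ⟨rfl, add_zero _, rfl⟩
  | lazyPair => cases hw; exact ⟨rfl, rfl, rfl⟩
  | inl _ ih =>
    cases hw with
    | inl h => obtain ⟨rfl, rfl, rfl⟩ := ih h; exact ⟨rfl, rfl, rfl⟩
  | inr _ ih =>
    cases hw with
    | inr h => obtain ⟨rfl, rfl, rfl⟩ := ih h; exact ⟨rfl, rfl, rfl⟩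
  | triv => cases hw; exact ⟨rfl, rfl, rfl⟩
  | zero => cases hw; exact ⟨rfl, rfl, rfl⟩
  | succ _ ih =>
    cases hw with
    | succ h => obtain ⟨rfl, rfl, rfl⟩ := ih h; exact ⟨rfl, rfl, rfl⟩
  | nil => cases hw; exact ⟨rfl, rfl, rfl⟩
  | cons _ _ ih₁ ih₂ =>
    cases hw with
    | cons h₁ h₂ =>
      obtain ⟨rfl, rfl, rfl⟩ := ih₁ h₁
      obtain ⟨rfl, rfl, rfl⟩ := ih₂ h₂
      exact ⟨rfl, add_zero _, rfl⟩

/-! ### Types of extracted recurrences -/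

theorem Ctx.potential_snoc {n : ℕ} (Γ : Ctx n) (A : Ty) :
    (fun i => (Γ.snoc A i).potential) = LamC.Ctx.snoc (fun i => (Γ i).potential) A.potential := by
  funext i
  exact Fin.cases rfl (fun i => rfl) i

section

variable {R : Type*}

/-- The step function `λ p. E (π₁ p, λ z. π₂ p)` of the recurrence extracted from a recursor on
numbers. -/
def natStep {n : ℕ} (E : LamC.Tm R n) : LamC.Tm R n :=
  .lam (.app E.weaken (.pair (.fst (.var 0)) (.lam (.snd (.var 1)))))

theorem natStep_subst {n m : ℕ} (θ : Fin n → LamC.Tm R m) (E : LamC.Tm R n) :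
    (natStep E).subst θ = natStep (E.subst θ) := by
  simp only [natStep, LamC.Tm.subst, LamC.Tm.subst_lift_weaken]
  rfl

theorem natStep_hasType {n : ℕ} {Γ : LamC.Ctx n} {E : LamC.Tm R n} {T : LamC.Ty}
    (h : LamC.HasType Γ E (.arr (.prod .nat (.arr .one T)) T)) :
    LamC.HasType Γ (natStep E) (.arr (.prod .nat T) T) :=
  .lam (.app (h.weaken _)
    (.pair (.fst (.var (Γ := Γ.snoc (.prod .nat T)) 0))
      (.lam (.snd (.var (Γ := (Γ.snoc (.prod .nat T)).snoc .one) 1)))))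

end

section

variable {R : Type*} [CommRing R]

/-- The step function `λ p. E (π₁ p, ((0, π₁ (π₂ p)), π₂ (π₂ p)))` of the recurrence extracted
from a recursor on lists. -/
def listStep {n : ℕ} (E : LamC.Tm R n) : LamC.Tm R n :=
  .lam (.app E.weaken (.pair (.fst (.var 0))
    (.pair (.pair (.const 0) (.fst (.snd (.var 0)))) (.snd (.snd (.var 0))))))

theorem listStep_subst {n m : ℕ} (θ : Fin n → LamC.Tm R m) (E : LamC.Tm R n) :
    (listStep E).subst θ = listStep (E.subst θ) := by
  simp only [listStep, LamC.Tm.subst, LamC.Tm.subst_lift_weaken]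
  rfl

theorem listStep_hasType {n : ℕ} {Γ : LamC.Ctx n} {E : LamC.Tm R n} {S T : LamC.Ty}
    (h : LamC.HasType Γ E (.arr (.prod S (.prod (.prod .cost (.list S)) T)) T)) :
    LamC.HasType Γ (listStep E) (.arr (.prod S (.prod (.list S) T)) T) :=
  have h0 : LamC.HasType (Γ.snoc (.prod S (.prod (.list S) T))) (.var 0 : LamC.Tm R _)
      (.prod S (.prod (.list S) T)) := .var 0
  .lam (.app (h.weaken _)
    (.pair (.fst h0) (.pair (.pair (.const 0) (.fst (.snd h0))) (.snd (.snd h0)))))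

/-- The recurrence extracted from a term of type `A` has the type of complexities of `A`. -/
theorem HasType.extract {n : ℕ} {Γ : Ctx n} {f : Res n} {M : Tm n} {A : Ty}
    (h : HasType Γ f M A) :
    LamC.HasType (fun i => (Γ i).potential) (M.extract R) A.complexity := by
  induction h with
  | var i _ => exact .pair (.const 0) (.var i)
  | tick _ h => exact .addCost (.const _) h
  | create _ h => exact .addCost (.const _) h
  | spend _ _ h => exact .addCost (.const _) h
  | save _ _ h => exact .pair (.times (.fst h)) (.snd h)
  | transfer _ _ _ h₁ h₂ =>
    rw [Ctx.potential_snoc] at h₂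
    exact .addCost (.times (.fst h₁)) (h₂.subst1 (.snd h₁))
  | lam _ h =>
    rw [Ctx.potential_snoc] at h
    exact .pair (.const 0) (.lam h)
  | app _ _ _ h₁ h₂ => exact .addCost (.plus (.fst h₁) (.fst h₂)) (.app (.snd h₁) (.snd h₂))
  | pair _ _ _ h₁ h₂ => exact .pair (.plus (.fst h₁) (.fst h₂)) (.pair (.snd h₁) (.snd h₂))
  | letPair _ _ _ h₁ h₂ =>
    rw [Ctx.potential_snoc, Ctx.potential_snoc] at h₂
    exact .addCost (.times (.fst h₁)) (h₂.subst (LamC.HasType.vecCons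
      (LamC.HasType.vecCons (fun i => .var i) (.fst (.snd h₁))) (.snd (.snd h₁))))
  | lazyPair _ _ h₁ h₂ => exact .pair (.const 0) (.pair h₁ h₂)
  | fst _ h => exact .addCost (.fst h) (.fst (.snd h))
  | snd _ h => exact .addCost (.fst h) (.snd (.snd h))
  | inl _ h => exact .pair (.fst h) (.inl (.snd h))
  | inr _ h => exact .pair (.fst h) (.inr (.snd h))
  | caseOf _ _ _ _ h h₁ h₂ =>
    rw [Ctx.potential_snoc] at h₁ h₂
    exact .addCost (.times (.fst h)) (.caseOf (.snd h) h₁ h₂)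
  | triv => exact .pair (.const 0) .triv
  | zero => exact .pair (.const 0) .zero
  | succ _ h => exact .pair (.fst h) (.succ (.snd h))
  | nrec _ _ _ _ h h₁ h₂ =>
    exact .addCost (.plus (.plus (.fst h) (.fst h₁)) (.fst h₂))
      (.nrec (.snd h) (.snd h₁) (natStep_hasType (.snd h₂)))
  | nil => exact .pair (.const 0) .nil
  | cons _ _ _ h₁ h₂ => exact .pair (.plus (.fst h₁) (.fst h₂)) (.cons (.snd h₁) (.snd h₂))
  | lrec _ _ _ _ h h₁ h₂ =>
    exact .addCost (.plus (.plus (.fst h) (.fst h₁)) (.fst h₂))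
      (.lrec (.snd h) (.snd h₁) (listStep_hasType (.snd h₂)))

end

/-! ### The logical relation -/

section

variable {R : Type*} [CommRing R] [LinearOrder R]

/-- The result `v` of an evaluation with `n` ticks and balance `r` is bounded by the complexity
`E`: the cost component of `E` is at least `n + r`, and the credits `a` that were available before
the evaluation and the balance `r` pay for a number `b` of credits with which `v` is bounded,
according to `V`, by the potential component of `E`. -/
def ResultBound (V : ℕ∞ → Tm 0 → LamC.Tm R 0 → Prop) (a : ℕ∞) (n : ℕ) (r : Balance) (v : Tm 0)
    (E : LamC.Tm R 0) : Prop :=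
  LamC.Le ![] .cost (.const (amort R n r)) (.fst E) ∧
    ∃ b, credit ℤ b ≤ credit ℤ a + r ∧ V b v (.snd E)

/-- A term that owns `a` credits is bounded by the complexity `E` if every result of its
evaluation is. -/
def TermBound (V : ℕ∞ → Tm 0 → LamC.Tm R 0 → Prop) (a : ℕ∞) (M : Tm 0) (E : LamC.Tm R 0) : Prop :=
  ∀ n r v, Eval M n r v → ResultBound V a n r v E

/-- A numeral is bounded by a potential above its image in the recurrence language, up to `≤` at
each constructor since the constructors need not be monotone. Numerals store no credits. -/
inductive NatBound : Tm 0 → LamC.Tm R 0 → Prop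
  | zero {E : LamC.Tm R 0} : LamC.Le ![] .nat .zero E → NatBound .zero E
  | succ {v : Tm 0} {E E' : LamC.Tm R 0} : LamC.HasType ![] E .nat → NatBound v E →
      LamC.Le ![] .nat (.succ E) E' → NatBound (.succ v) E'

/-- The bounding relation on lists with entries bounded by `V`, at the potential type `T`; the
credits of a list are shared among its entries. -/
inductive ListBound (V : ℕ∞ → Tm 0 → LamC.Tm R 0 → Prop) (T : LamC.Ty) :
    ℕ∞ → Tm 0 → LamC.Tm R 0 → Prop
  | nil {a : ℕ∞} {E : LamC.Tm R 0} : LamC.Le ![] (.list T) .nil E → ListBound V T a .nil E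
  | cons {a a₁ a₂ : ℕ∞} {v₁ v₂ : Tm 0} {E₁ E₂ E : LamC.Tm R 0} : a₁ + a₂ ≤ a →
      LamC.HasType ![] E₁ T → LamC.HasType ![] E₂ (.list T) → V a₁ v₁ E₁ →
      ListBound V T a₂ v₂ E₂ → LamC.Le ![] (.list T) (.cons E₁ E₂) E →
      ListBound V T a (.cons v₁ v₂) E

/-- The logical relation: the value `v` of the given type, which stores at most `a` credits, is
bounded by the potential `E`. -/
def ValBound : Ty → ℕ∞ → Tm 0 → LamC.Tm R 0 → Prop
  | .bang k l A, a, v, E => ∃ c u, v = .save k l u ∧ k.1 * c + l ≤ a ∧ ValBound A c u E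
  | .lolli A B, a, v, E => ∃ M, v = .lam M ∧ ∀ b u E', LamC.HasType ![] E' A.potential →
      ValBound A b u E' → TermBound (ValBound B) (a + b) (M.subst1 u) (.app E E')
  | .tensor A B, a, v, E => ∃ a₁ a₂ v₁ v₂, v = .pair v₁ v₂ ∧ a₁ + a₂ ≤ a ∧
      ValBound A a₁ v₁ (.fst E) ∧ ValBound B a₂ v₂ (.snd E)
  | .amp A B, a, v, E => ∃ M N, v = .lazyPair M N ∧
      TermBound (ValBound A) a M (.fst E) ∧ TermBound (ValBound B) a N (.snd E)
  | .oplus A B, a, v, E =>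
      (∃ u E', v = .inl u ∧ LamC.HasType ![] E' A.potential ∧ ValBound A a u E' ∧
        LamC.Le ![] (.sum A.potential B.potential) (.inl E') E) ∨
      (∃ u E', v = .inr u ∧ LamC.HasType ![] E' B.potential ∧ ValBound B a u E' ∧
        LamC.Le ![] (.sum A.potential B.potential) (.inr E') E)
  | .one, _, v, _ => v = .triv
  | .nat, _, v, E => NatBound v E
  | .list A, a, v, E => ListBound (ValBound A) A.potential a v E

theorem NatBound.isValue {v : Tm 0} {E : LamC.Tm R 0} (h : NatBound v E) : IsValue v := by
  induction h with
  | zero _ => exact .zero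
  | succ _ _ _ ih => exact .succ ih

theorem NatBound.mono {v : Tm 0} {E E' : LamC.Tm R 0} (h : NatBound v E)
    (hE : LamC.Le ![] .nat E E') : NatBound v E' := by
  cases h with
  | zero h => exact .zero (h.trans hE)
  | succ ht h h' => exact .succ ht h (h'.trans hE)

theorem ListBound.mono {V : ℕ∞ → Tm 0 → LamC.Tm R 0 → Prop} {T : LamC.Ty} {a a' : ℕ∞} {v : Tm 0}
    {E E' : LamC.Tm R 0} (h : ListBound V T a v E) (ha : a ≤ a')
    (hE : LamC.Le ![] (.list T) E E') : ListBound V T a' v E' := by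
  cases h with
  | nil h => exact .nil (h.trans hE)
  | cons hs ht₁ ht₂ h₁ h₂ h => exact .cons (hs.trans ha) ht₁ ht₂ h₁ h₂ (h.trans hE)

theorem ValBound.isValue {A : Ty} {a : ℕ∞} {v : Tm 0} {E : LamC.Tm R 0} (h : ValBound A a v E) :
    IsValue v := by
  induction A generalizing a v E with
  | bang k l A ih => obtain ⟨c, u, rfl, -, h⟩ := h; exact .save (ih h)
  | lolli A B => obtain ⟨M, rfl, -⟩ := h; exact .lam
  | tensor A B ihA ihB =>
    obtain ⟨a₁, a₂, v₁, v₂, rfl, -, h₁, h₂⟩ := h; exact .pair (ihA h₁) (ihB h₂)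
  | amp A B => obtain ⟨M, N, rfl, -⟩ := h; exact .lazyPair
  | oplus A B ihA ihB =>
    obtain ⟨u, E', rfl, -, h, -⟩ | ⟨u, E', rfl, -, h, -⟩ := h
    · exact .inl (ihA h)
    · exact .inr (ihB h)
  | one => cases h; exact .triv
  | nat => exact NatBound.isValue h
  | list A ih =>
    change ListBound _ _ _ _ _ at h
    induction h with
    | nil => exact .nil
    | cons _ _ _ h _ _ ih' => exact .cons (ih h) ih'

/-- Credits may be added, and potentials may be increased. -/
theorem ValBound.mono {A : Ty} {a a' : ℕ∞} {v : Tm 0} {E E' : LamC.Tm R 0} (h : ValBound A a v E)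
    (ha : a ≤ a') (hE : LamC.Le ![] A.potential E E') : ValBound A a' v E' := by
  induction A generalizing a a' v E E' with
  | bang k l A ih =>
    obtain ⟨c, u, rfl, hc, h⟩ := h
    exact ⟨c, u, rfl, hc.trans ha, ih h le_rfl hE⟩
  | lolli A B _ ihB =>
    obtain ⟨M, rfl, h⟩ := h
    refine ⟨M, rfl, fun b u E₁ ht hu n r w hw => ?_⟩
    obtain ⟨hc, d, hd, hV⟩ := h b u E₁ ht hu n r w hw
    have hE' : LamC.Le ![] (Ty.complexity B) (.app E E₁) (.app E' E₁) := .app hE ht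
    exact ⟨hc.trans (.fst hE'), d, hd.trans (by gcongr; exact ExtCost.credit_mono (by gcongr)),
      ihB hV le_rfl (.snd hE')⟩
  | tensor A B ihA ihB =>
    obtain ⟨a₁, a₂, v₁, v₂, rfl, hs, h₁, h₂⟩ := h
    exact ⟨a₁, a₂, v₁, v₂, rfl, hs.trans ha, ihA h₁ le_rfl (.fst hE), ihB h₂ le_rfl (.snd hE)⟩
  | amp A B ihA ihB =>
    obtain ⟨M, N, rfl, h₁, h₂⟩ := h
    refine ⟨M, N, rfl, fun n r w hw => ?_, fun n r w hw => ?_⟩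
    · obtain ⟨hc, d, hd, hV⟩ := h₁ n r w hw
      have hE' : LamC.Le ![] (Ty.complexity A) (.fst E) (.fst E') := .fst hE
      exact ⟨hc.trans (.fst hE'), d, hd.trans (by gcongr; exact ExtCost.credit_mono ha),
        ihA hV le_rfl (.snd hE')⟩
    · obtain ⟨hc, d, hd, hV⟩ := h₂ n r w hw
      have hE' : LamC.Le ![] (Ty.complexity B) (.snd E) (.snd E') := .snd hE
      exact ⟨hc.trans (.fst hE'), d, hd.trans (by gcongr; exact ExtCost.credit_mono ha),
        ihB hV le_rfl (.snd hE')⟩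
  | oplus A B ihA ihB =>
    obtain ⟨u, E₁, rfl, ht, h, hl⟩ | ⟨u, E₁, rfl, ht, h, hl⟩ := h
    · exact .inl ⟨u, E₁, rfl, ht, ihA h ha (.refl ht), hl.trans hE⟩
    · exact .inr ⟨u, E₁, rfl, ht, ihB h ha (.refl ht), hl.trans hE⟩
  | one => exact h
  | nat => exact NatBound.mono h hE
  | list A => exact ListBound.mono h ha hE

theorem ResultBound.mono {A : Ty} {a a' : ℕ∞} {n : ℕ} {r : Balance} {v : Tm 0}
    {E E' : LamC.Tm R 0} (h : ResultBound (ValBound A) a n r v E) (ha : a ≤ a')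
    (hE : LamC.Le ![] A.complexity E E') : ResultBound (ValBound A) a' n r v E' := by
  obtain ⟨hc, b, hb, hV⟩ := h
  exact ⟨hc.trans (.fst hE), b, hb.trans (by gcongr; exact ExtCost.credit_mono ha),
    hV.mono le_rfl (.snd hE)⟩

theorem TermBound.mono {A : Ty} {a a' : ℕ∞} {M : Tm 0} {E E' : LamC.Tm R 0}
    (h : TermBound (ValBound A) a M E) (ha : a ≤ a') (hE : LamC.Le ![] A.complexity E E') :
    TermBound (ValBound A) a' M E' :=
  fun n r v hv => (h n r v hv).mono ha hE

end

end LamA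

/-! ### Bounds for amortized costs and for results -/

namespace LamC

variable {R : Type*} [CommRing R] [LinearOrder R] {n : ℕ} {Γ : Ctx n}

theorem Le.const_plus {c d : ExtCost R} {E E' : Tm R n} (h : Le Γ .cost (.const c) E)
    (h' : Le Γ .cost (.const d) E') : Le Γ .cost (.const (c + d)) (.plus E E') :=
  constPlus.trans (.plus h h')

theorem Le.const_times {c : ExtCost R} {E : Tm R n} (k : Mult) (h : Le Γ .cost (.const c) E) :
    Le Γ .cost (.const (ExtCost.scale k c)) (.times k E) :=
  constTimes.trans (.times h)

/-- The `β`-reduct of a step function on numbers is bounded by its redex. -/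
theorem Le.natStep {E P : Tm R n} {T : Ty} (h : HasType Γ E (.arr (.prod .nat (.arr .one T)) T))
    (hP : HasType Γ P (.prod .nat T)) :
    Le Γ T (.app E (.pair (.fst P) (.lam (.snd P.weaken)))) (.app (LamA.natStep E) P) := by
  have := Le.beta (Γ := Γ) (E := (.app E.weaken (.pair (.fst (.var 0)) (.lam (.snd (.var 1))))))
    (.app (h.weaken _) (.pair (.fst (.var (Γ := Γ.snoc (.prod .nat T)) 0))
      (.lam (.snd (.var (Γ := (Γ.snoc (.prod .nat T)).snoc .one) 1))))) hP
  have e := Tm.weaken_subst1 E P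
  simp only [Tm.subst1, Tm.subst] at this e
  rw [e] at this
  exact this

/-- The `β`-reduct of a step function on lists is bounded by its redex. -/
theorem Le.listStep {E P : Tm R n} {S T : Ty}
    (h : HasType Γ E (.arr (.prod S (.prod (.prod .cost (.list S)) T)) T))
    (hP : HasType Γ P (.prod S (.prod (.list S) T))) :
    Le Γ T (.app E (.pair (.fst P) (.pair (.pair (.const 0) (.fst (.snd P))) (.snd (.snd P)))))
      (.app (LamA.listStep E) P) := by
  have h0 : LamC.HasType (Γ.snoc (.prod S (.prod (.list S) T))) (.var 0 : LamC.Tm R _)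
      (.prod S (.prod (.list S) T)) := .var 0
  have := Le.beta (Γ := Γ) (.app (h.weaken _) (.pair (.fst h0)
    (.pair (.pair (.const 0) (.fst (.snd h0))) (.snd (.snd h0))))) hP
  have e := Tm.weaken_subst1 E P
  simp only [Tm.subst1, Tm.subst] at this e
  rw [e] at this
  exact this

end LamC

namespace LamA

open ExtCost (amort credit)

section

variable {R : Type*} [CommRing R] [LinearOrder R]

theorem ResultBound.pair {A : Ty} {a b : ℕ∞} {n : ℕ} {r : Balance} {v : Tm 0}
    {C P : LamC.Tm R 0} (hC : LamC.HasType ![] C .cost) (hP : LamC.HasType ![] P A.potential)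
    (hc : LamC.Le ![] .cost (.const (amort R n r)) C) (hb : credit ℤ b ≤ credit ℤ a + r)
    (hV : ValBound A b v P) : ResultBound (ValBound A) a n r v (.pair C P) :=
  ⟨hc.trans (.fstPair hC hP), b, hb, hV.mono le_rfl (.sndPair hC hP)⟩

theorem ResultBound.addCost {A : Ty} {a b : ℕ∞} {n m : ℕ} {r s : Balance} {v : Tm 0}
    {c : ExtCost R} {C E : LamC.Tm R 0} (hE : ResultBound (ValBound A) b m s v E)
    (hCt : LamC.HasType ![] C .cost) (hEt : LamC.HasType ![] E A.complexity)
    (hC : LamC.Le ![] .cost (.const c) C) (hc : amort R n r ≤ c + amort R m s)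
    (hb : credit ℤ b + s ≤ credit ℤ a + r) :
    ResultBound (ValBound A) a n r v (.addCost C E) := by
  obtain ⟨h, d, hd, hV⟩ := hE
  exact .pair (.plus hCt (.fst hEt)) (.snd hEt) ((LamC.Le.const hc).trans (hC.const_plus h))
    (hd.trans hb) hV

/-- The bounding of `transfer`, `split` and `case`: the scrutinee is evaluated with credits `f`,
of which `b` are left; both are counted `j` times. -/
theorem ResultBound.bind [IsStrictOrderedRing R] {C : Ty} {j : Mult} {f g b : ℕ∞} {n₁ n₂ : ℕ} {r₁ r₂ : Balance} {w : Tm 0}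
    {T : LamC.Ty} {E X : LamC.Tm R 0} (hEt : LamC.HasType ![] E (.prod .cost T))
    (hXt : LamC.HasType ![] X C.complexity)
    (hE : LamC.Le ![] .cost (.const (amort R n₁ r₁)) (.fst E))
    (hb : credit ℤ b ≤ credit ℤ f + r₁)
    (hX : ResultBound (ValBound C) (g + j.1 * b) n₂ r₂ w X) :
    ResultBound (ValBound C) (j.1 * f + g) (n₁ + n₂) (ExtCost.scale j r₁ + r₂) w
      (.addCost (.times j (.fst E)) X) := by
  refine hX.addCost (.times (.fst hEt)) hXt (hE.const_times j) ?_ ?_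
  · rw [ExtCost.amort_add]
    gcongr
    exact ExtCost.amort_scale_le j n₁ r₁
  · rw [ExtCost.credit_add, ExtCost.credit_add]
    calc credit ℤ g + credit ℤ (j.1 * b) + r₂
        ≤ credit ℤ g + (credit ℤ (j.1 * f) + ExtCost.scale j r₁) + r₂ := by
          gcongr; exact ExtCost.credit_mul_le hb
      _ = _ := by ac_rfl

theorem add_credit_le {f g b₁ b₂ : ℕ∞} {r₁ r₂ : Balance} (h₁ : credit ℤ b₁ ≤ credit ℤ f + r₁)
    (h₂ : credit ℤ b₂ ≤ credit ℤ g + r₂) :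
    credit ℤ (b₁ + b₂) ≤ credit ℤ (f + g) + (r₁ + r₂) := by
  rw [ExtCost.credit_add, ExtCost.credit_add]
  exact (add_le_add h₁ h₂).trans_eq (add_add_add_comm _ _ _ _)

/-- A value is bounded by a complexity with cost `0` if it is bounded by the potential. -/
theorem ValBound.termBound {A : Ty} {a : ℕ∞} {v : Tm 0} {E : LamC.Tm R 0}
    (h : ValBound A a v E) (ht : LamC.HasType ![] E A.potential) :
    TermBound (ValBound A) a v (.pair (.const 0) E) := by
  intro n r w hw
  obtain ⟨rfl, rfl, rfl⟩ := h.isValue.eq_of_eval hw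
  refine .pair (.const 0) ht ?_ (add_zero _).ge h
  rw [ExtCost.amort_zero]
  exact .refl (.const 0)

/-! ### Compatibility with the term formers -/

theorem TermBound.tick {A : Ty} {a : ℕ∞} {M : Tm 0} {E : LamC.Tm R 0}
    (ht : LamC.HasType ![] E A.complexity) (h : TermBound (ValBound A) a M E) :
    TermBound (ValBound A) a (.tick M) (.addCost (.const (ExtCost.fin 1)) E) := by
  intro n r v hv
  cases hv with
  | tick hv =>
    refine (h _ _ _ hv).addCost (.const _) ht (.refl (.const _)) (le_of_eq ?_) le_rfl
    simp only [amort, Nat.cast_add, Nat.cast_one, ExtCost.fin_add]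
    ac_rfl

theorem TermBound.create {A : Ty} {a l : ℕ∞} {M : Tm 0} {E : LamC.Tm R 0}
    (ht : LamC.HasType ![] E A.complexity) (h : TermBound (ValBound A) (a + l) M E) :
    TermBound (ValBound A) a (.create l M) (.addCost (.const (credit R l)) E) := by
  intro n r v hv
  cases hv with
  | create hv =>
    refine (h _ _ _ hv).addCost (.const _) ht (.refl (.const _)) (le_of_eq ?_) (le_of_eq ?_)
    · simp only [amort, map_add, ExtCost.ofInt_credit]
      ac_rfl
    · rw [ExtCost.credit_add]
      ac_rfl

theorem TermBound.spend {A : Ty} {a l : ℕ∞} {M : Tm 0} {E : LamC.Tm R 0}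
    (ht : LamC.HasType ![] E A.complexity) (h : TermBound (ValBound A) a M E) :
    TermBound (ValBound A) (a + l) (.spend l M) (.addCost (.const (ExtCost.debit R l)) E) := by
  intro n r v hv
  cases hv with
  | @spend _ _ _ _ r hv =>
    refine (h _ _ _ hv).addCost (.const _) ht (.refl (.const _)) (le_of_eq ?_) ?_
    · simp only [amort, map_add, ExtCost.ofInt_debit]
      ac_rfl
    · calc credit ℤ a + r ≤ credit ℤ (a + l) + ExtCost.debit ℤ l + r := by
            gcongr; exact ExtCost.credit_le_credit_add_debit a l
        _ = _ := by ac_rfl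

theorem TermBound.app {A B : Ty} {f g : ℕ∞} {M N : Tm 0} {E E' : LamC.Tm R 0}
    (ht : LamC.HasType ![] E (Ty.lolli A B).complexity) (ht' : LamC.HasType ![] E' A.complexity)
    (h : TermBound (ValBound (.lolli A B)) f M E) (h' : TermBound (ValBound A) g N E') :
    TermBound (ValBound B) (f + g) (.app M N)
      (.addCost (.plus (.fst E) (.fst E')) (.app (.snd E) (.snd E'))) := by
  intro n r w hw
  cases hw with
  | app hM hN hw =>
    obtain ⟨hc₁, b₁, hb₁, M', hM', hV₁⟩ := h _ _ _ hM
    cases hM'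
    obtain ⟨hc₂, b₂, hb₂, hV₂⟩ := h' _ _ _ hN
    refine (hV₁ b₂ _ _ (.snd ht') hV₂ _ _ _ hw).addCost (.plus (.fst ht) (.fst ht'))
      (.app (.snd ht) (.snd ht')) (hc₁.const_plus hc₂) (le_of_eq ?_) ?_
    · simp only [ExtCost.amort_add]
    · rw [← add_assoc]
      gcongr
      exact add_credit_le hb₁ hb₂

theorem TermBound.pair {A B : Ty} {f g : ℕ∞} {M N : Tm 0} {E E' : LamC.Tm R 0}
    (ht : LamC.HasType ![] E A.complexity) (ht' : LamC.HasType ![] E' B.complexity)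
    (h : TermBound (ValBound A) f M E) (h' : TermBound (ValBound B) g N E') :
    TermBound (ValBound (.tensor A B)) (f + g) (.pair M N)
      (.pair (.plus (.fst E) (.fst E')) (.pair (.snd E) (.snd E'))) := by
  intro n r w hw
  cases hw with
  | pair hM hN =>
    obtain ⟨hc₁, b₁, hb₁, hV₁⟩ := h _ _ _ hM
    obtain ⟨hc₂, b₂, hb₂, hV₂⟩ := h' _ _ _ hN
    refine .pair (.plus (.fst ht) (.fst ht')) (.pair (.snd ht) (.snd ht')) ?_
      (add_credit_le hb₁ hb₂)
      ⟨b₁, b₂, _, _, rfl, le_rfl, hV₁.mono le_rfl (.fstPair (.snd ht) (.snd ht')),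
        hV₂.mono le_rfl (.sndPair (.snd ht) (.snd ht'))⟩
    rw [ExtCost.amort_add]
    exact hc₁.const_plus hc₂

theorem TermBound.cons {A : Ty} {f g : ℕ∞} {M N : Tm 0} {E E' : LamC.Tm R 0}
    (ht : LamC.HasType ![] E A.complexity) (ht' : LamC.HasType ![] E' (Ty.list A).complexity)
    (h : TermBound (ValBound A) f M E) (h' : TermBound (ValBound (.list A)) g N E') :
    TermBound (ValBound (.list A)) (f + g) (.cons M N)
      (.pair (.plus (.fst E) (.fst E')) (.cons (.snd E) (.snd E'))) := by
  intro n r w hw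
  cases hw with
  | cons hM hN =>
    obtain ⟨hc₁, b₁, hb₁, hV₁⟩ := h _ _ _ hM
    obtain ⟨hc₂, b₂, hb₂, hV₂⟩ := h' _ _ _ hN
    refine .pair (.plus (.fst ht) (.fst ht')) (.cons (.snd ht) (.snd ht')) ?_
      (add_credit_le hb₁ hb₂) (ListBound.cons le_rfl (.snd ht) (.snd ht') hV₁ hV₂
        (.refl (.cons (.snd ht) (.snd ht'))))
    rw [ExtCost.amort_add]
    exact hc₁.const_plus hc₂

theorem TermBound.fst {A B : Ty} {f : ℕ∞} {M : Tm 0} {E : LamC.Tm R 0}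
    (ht : LamC.HasType ![] E (Ty.amp A B).complexity) (h : TermBound (ValBound (.amp A B)) f M E) :
    TermBound (ValBound A) f (.fst M) (.addCost (.fst E) (.fst (.snd E))) := by
  intro n r w hw
  cases hw with
  | fst hM hw =>
    obtain ⟨hc, b, hb, M', N', hMN, hV, -⟩ := h _ _ _ hM
    cases hMN
    refine (hV _ _ _ hw).addCost (.fst ht) (.fst (.snd ht)) hc (le_of_eq ?_) ?_
    · rw [ExtCost.amort_add]
    · rw [← add_assoc]
      gcongr

theorem TermBound.snd {A B : Ty} {f : ℕ∞} {M : Tm 0} {E : LamC.Tm R 0}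
    (ht : LamC.HasType ![] E (Ty.amp A B).complexity) (h : TermBound (ValBound (.amp A B)) f M E) :
    TermBound (ValBound B) f (.snd M) (.addCost (.fst E) (.snd (.snd E))) := by
  intro n r w hw
  cases hw with
  | snd hM hw =>
    obtain ⟨hc, b, hb, M', N', hMN, -, hV⟩ := h _ _ _ hM
    cases hMN
    refine (hV _ _ _ hw).addCost (.fst ht) (.snd (.snd ht)) hc (le_of_eq ?_) ?_
    · rw [ExtCost.amort_add]
    · rw [← add_assoc]
      gcongr

theorem TermBound.inl {A B : Ty} {f : ℕ∞} {M : Tm 0} {E : LamC.Tm R 0}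
    (ht : LamC.HasType ![] E A.complexity) (h : TermBound (ValBound A) f M E) :
    TermBound (ValBound (.oplus A B)) f (.inl M) (.pair (.fst E) (.inl (.snd E))) := by
  intro n r w hw
  cases hw with
  | inl hM =>
    obtain ⟨hc, b, hb, hV⟩ := h _ _ _ hM
    exact .pair (.fst ht) (.inl (.snd ht)) hc hb
      (.inl ⟨_, _, rfl, .snd ht, hV, .refl (.inl (.snd ht))⟩)

theorem TermBound.inr {A B : Ty} {f : ℕ∞} {M : Tm 0} {E : LamC.Tm R 0}
    (ht : LamC.HasType ![] E B.complexity) (h : TermBound (ValBound B) f M E) :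
    TermBound (ValBound (.oplus A B)) f (.inr M) (.pair (.fst E) (.inr (.snd E))) := by
  intro n r w hw
  cases hw with
  | inr hM =>
    obtain ⟨hc, b, hb, hV⟩ := h _ _ _ hM
    exact .pair (.fst ht) (.inr (.snd ht)) hc hb
      (.inr ⟨_, _, rfl, .snd ht, hV, .refl (.inr (.snd ht))⟩)

theorem TermBound.succ {f : ℕ∞} {M : Tm 0} {E : LamC.Tm R 0}
    (ht : LamC.HasType ![] E Ty.nat.complexity) (h : TermBound (ValBound .nat) f M E) :
    TermBound (ValBound .nat) f (.succ M) (.pair (.fst E) (.succ (.snd E))) := by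
  intro n r w hw
  cases hw with
  | succ hM =>
    obtain ⟨hc, b, hb, hV⟩ := h _ _ _ hM
    exact .pair (A := .nat) (.fst ht) (.succ (.snd ht)) hc hb
      (NatBound.succ (.snd ht) hV (.refl (.succ (.snd ht))))

section

variable [IsStrictOrderedRing R]

theorem TermBound.save {A : Ty} {f a l : ℕ∞} {k : Mult} {M : Tm 0} {E : LamC.Tm R 0}
    (ht : LamC.HasType ![] E A.complexity) (h : TermBound (ValBound A) f M E)
    (ha : k.1 * f + l ≤ a) :
    TermBound (ValBound (.bang k l A)) a (.save k l M) (.pair (.times k (.fst E)) (.snd E)) := by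
  intro n r w hw
  cases hw with
  | @save _ _ _ _ _ r hM =>
    obtain ⟨hc, b, hb, hV⟩ := h _ _ _ hM
    refine .pair (A := .bang k l A) (b := k.1 * b + l) (.times (.fst ht)) (.snd ht)
      ((LamC.Le.const (ExtCost.amort_scale_le k _ _)).trans (hc.const_times k)) ?_
      ⟨b, _, rfl, le_rfl, hV⟩
    calc credit ℤ (k.1 * b + l)
        ≤ credit ℤ (k.1 * f) + ExtCost.scale k r + credit ℤ l := by
          rw [ExtCost.credit_add]; gcongr; exact ExtCost.credit_mul_le hb
      _ = credit ℤ (k.1 * f + l) + ExtCost.scale k r := by rw [ExtCost.credit_add]; ac_rfl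
      _ ≤ _ := by gcongr; exact ExtCost.credit_mono ha

theorem TermBound.transfer {A C : Ty} {f g l : ℕ∞} {j k : Mult} {M : Tm 0} {N : Tm 1}
    {E X : LamC.Tm R 0} (ht : LamC.HasType ![] E (Ty.bang k l A).complexity)
    (hXt : LamC.HasType ![] X C.complexity) (h : TermBound (ValBound (.bang k l A)) f M E)
    (hX : ∀ c v, ValBound A c v (.snd E) →
      TermBound (ValBound C) (g + j.1 * (k.1 * c + l)) (N.subst1 v) X) :
    TermBound (ValBound C) (j.1 * f + g) (.transfer j k l M N)
      (.addCost (.times j (.fst E)) X) := by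
  intro n r w hw
  cases hw with
  | transfer hM hw =>
    obtain ⟨hc, b, hb, c, u, hu, hcb, hV⟩ := h _ _ _ hM
    cases hu
    exact .bind ht hXt hc hb ((hX c _ hV _ _ _ hw).mono (by gcongr) (.refl hXt))

theorem TermBound.letPair {A B C : Ty} {f g : ℕ∞} {j : Mult} {M : Tm 0} {N : Tm 2}
    {E X : LamC.Tm R 0} (ht : LamC.HasType ![] E (Ty.tensor A B).complexity)
    (hXt : LamC.HasType ![] X C.complexity) (h : TermBound (ValBound (.tensor A B)) f M E)
    (hX : ∀ a b v w, ValBound A a v (.fst (.snd E)) → ValBound B b w (.snd (.snd E)) →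
      TermBound (ValBound C) (g + j.1 * (a + b)) (N.subst2 v w) X) :
    TermBound (ValBound C) (j.1 * f + g) (.letPair j M N)
      (.addCost (.times j (.fst E)) X) := by
  intro n r w hw
  cases hw with
  | letPair hM hw =>
    obtain ⟨hc, b, hb, b₁, b₂, v₁, v₂, hv, hs, hV₁, hV₂⟩ := h _ _ _ hM
    cases hv
    exact .bind ht hXt hc hb ((hX b₁ b₂ _ _ hV₁ hV₂ _ _ _ hw).mono (by gcongr) (.refl hXt))

theorem TermBound.caseOf {A B C : Ty} {f g : ℕ∞} {j : Mult} {M : Tm 0} {N₁ N₂ : Tm 1}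
    {E : LamC.Tm R 0} {E₁ E₂ : LamC.Tm R 1} (ht : LamC.HasType ![] E (Ty.oplus A B).complexity)
    (ht₁ : LamC.HasType (LamC.Ctx.snoc ![] A.potential) E₁ C.complexity)
    (ht₂ : LamC.HasType (LamC.Ctx.snoc ![] B.potential) E₂ C.complexity)
    (h : TermBound (ValBound (.oplus A B)) f M E)
    (h₁ : ∀ b v E', LamC.HasType ![] E' A.potential → ValBound A b v E' →
      TermBound (ValBound C) (g + j.1 * b) (N₁.subst1 v) (E₁.subst1 E'))
    (h₂ : ∀ b v E', LamC.HasType ![] E' B.potential → ValBound B b v E' →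
      TermBound (ValBound C) (g + j.1 * b) (N₂.subst1 v) (E₂.subst1 E')) :
    TermBound (ValBound C) (j.1 * f + g) (.caseOf j M N₁ N₂)
      (.addCost (.times j (.fst E)) (.caseOf (.snd E) E₁ E₂)) := by
  intro n r w hw
  cases hw with
  | caseInl hM hw =>
    obtain ⟨hc, b, hb, ⟨u, E', hu, ht', hV, hl⟩ | ⟨u, E', hu, -⟩⟩ := h _ _ _ hM
    · cases hu
      exact .bind ht (.caseOf (.snd ht) ht₁ ht₂) hc hb ((h₁ b _ _ ht' hV _ _ _ hw).mono le_rfl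
        ((LamC.Le.caseInl ht' ht₁ ht₂).trans (.caseOf hl ht₁ ht₂)))
    · cases hu
  | caseInr hM hw =>
    obtain ⟨hc, b, hb, ⟨u, E', hu, -⟩ | ⟨u, E', hu, ht', hV, hl⟩⟩ := h _ _ _ hM
    · cases hu
    · cases hu
      exact .bind ht (.caseOf (.snd ht) ht₁ ht₂) hc hb ((h₂ b _ _ ht' hV _ _ _ hw).mono le_rfl
        ((LamC.Le.caseInr ht' ht₁ ht₂).trans (.caseOf hl ht₁ ht₂)))

end

/-! ### Recursors -/

/-- An infinite supply of `c` pays for one more `c`. -/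
theorem add_top_mul (c : ℕ∞) : c + ⊤ * c = ⊤ * c := by
  rw [← one_add_mul, add_top]

/-- A recursor on numbers whose arguments are values is bounded by the extracted recurrence; by
induction on the number. Its step function has infinitely many copies, so its credits `c` are
multiplied by `∞`. -/
theorem NatBound.nrec {C : Ty} {b c : ℕ∞} {v : Tm 0} {N₁ N₂ : Tm 1} {E E₁ E₂ : LamC.Tm R 0}
    (ht₁ : LamC.HasType ![] E₁ (Ty.lolli .one C).potential)
    (ht₂ : LamC.HasType ![] E₂ (Ty.lolli (.tensor .nat (.lolli .one C)) C).potential)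
    (h₁ : ValBound (.lolli .one C) b (.lam N₁) E₁)
    (h₂ : ValBound (.lolli (.tensor .nat (.lolli .one C)) C) c (.lam N₂) E₂)
    (h : NatBound v E) :
    TermBound (ValBound C) (b + ⊤ * c) (.nrec v (.lam N₁) (.save .infty 0 (.lam N₂)))
      (.nrec E E₁ (natStep E₂)) := by
  have hs : LamC.HasType ![] (natStep E₂) (.arr (.prod .nat C.complexity) C.complexity) :=
    natStep_hasType ht₂
  have hsv : IsValue (.save .infty 0 (.lam N₂)) := .save .lam
  obtain ⟨_, e₁, hV₁⟩ := h₁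
  cases e₁
  obtain ⟨_, e₂, hV₂⟩ := h₂
  cases e₂
  induction h with
  | zero hl =>
    intro n r w hw
    cases hw with
    | nrecZero hv hN₁ hN₂ hw =>
      obtain ⟨rfl, rfl, -⟩ := IsValue.zero.eq_of_eval hv
      obtain ⟨rfl, rfl, e⟩ := IsValue.lam.eq_of_eval hN₁
      cases e
      obtain ⟨rfl, rfl, -⟩ := hsv.eq_of_eval hN₂
      simp only [add_zero, zero_add]
      exact (hV₁ 0 _ _ .triv rfl _ _ _ hw).mono (by simp)
        ((LamC.Le.nrecZero ht₁ hs).trans (.nrec hl ht₁ hs))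
    | nrecSucc hv => cases hv
  | @succ v E E' ht hv hl ih =>
    intro n r w hw
    cases hw with
    | nrecZero hv => cases hv
    | nrecSucc hv' hN₁ hN₂ hw =>
      obtain ⟨rfl, rfl, e⟩ := hv.isValue.succ.eq_of_eval hv'
      cases e
      obtain ⟨rfl, rfl, e⟩ := IsValue.lam.eq_of_eval hN₁
      cases e
      obtain ⟨rfl, rfl, e⟩ := hsv.eq_of_eval hN₂
      cases e
      simp only [add_zero, zero_add]
      have htP : LamC.HasType ![] (.pair E (.nrec E E₁ (natStep E₂)))
        (.prod .nat C.complexity) := .pair ht (.nrec ht ht₁ hs)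
      -- `P` is the argument of the step function of the recurrence, and `htZ` types the body of
      -- the constant function `λ z. π₂ P` that stands for the suspended recursive call.
      have htZ := LamC.HasType.snd (htP.weaken .one)
      set P : LamC.Tm R 0 := .pair E (.nrec E E₁ (natStep E₂))
      have htL : LamC.HasType ![] (.lam (.snd P.weaken)) (Ty.lolli .one C).potential := .lam htZ
      have hPb : ValBound (.tensor .nat (.lolli .one C)) (0 + (b + ⊤ * c))
          (.pair v (.lam (Tm.weaken (.nrec v (.lam N₁) (.save .infty 0 (.lam N₂))))))
          (.pair (.fst P) (.lam (.snd P.weaken))) := by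
        refine ⟨0, b + ⊤ * c, _, _, rfl, le_rfl, ?_, _, rfl, fun d u E'' ht'' _ => ?_⟩
        · exact hv.mono ((LamC.Le.fstPair ht (.nrec ht ht₁ hs)).trans (.fstPair (.fst htP) htL))
        · rw [Tm.weaken_subst1]
          have hβ := LamC.Le.beta htZ ht''
          have e : (LamC.Tm.snd P.weaken).subst1 E'' = .snd P :=
            congrArg LamC.Tm.snd (LamC.Tm.weaken_subst1 P E'')
          rw [e] at hβ
          exact ih.mono le_self_add (((LamC.Le.sndPair ht (.nrec ht ht₁ hs)).trans hβ).trans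
            (.app (.sndPair (.fst htP) htL) ht''))
      refine (hV₂ _ _ _ (.pair (.fst htP) htL) hPb _ _ _ hw).mono (le_of_eq ?_)
        (((LamC.Le.natStep ht₂ htP).trans (.nrecSucc ht ht₁ hs)).trans (.nrec hl ht₁ hs))
      rw [zero_add, add_left_comm, add_top_mul]

/-- A recursor on lists whose arguments are values is bounded by the extracted recurrence; by
induction on the list. The tail and the recursive call share their credits, since they form a
lazy pair. -/
theorem ListBound.lrec {A C : Ty} {a b c : ℕ∞} {v : Tm 0} {N₁ N₂ : Tm 1} {E E₁ E₂ : LamC.Tm R 0}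
    (ht₁ : LamC.HasType ![] E₁ (Ty.lolli .one C).potential)
    (ht₂ : LamC.HasType ![] E₂ (Ty.lolli (.tensor A (.amp (.list A) C)) C).potential)
    (h₁ : ValBound (.lolli .one C) b (.lam N₁) E₁)
    (h₂ : ValBound (.lolli (.tensor A (.amp (.list A) C)) C) c (.lam N₂) E₂)
    (h : ListBound (ValBound A) A.potential a v E) :
    TermBound (ValBound C) (a + (b + ⊤ * c)) (.lrec v (.lam N₁) (.save .infty 0 (.lam N₂)))
      (.lrec E E₁ (listStep E₂)) := by
  have hs : LamC.HasType ![] (listStep E₂)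
    (.arr (.prod A.potential (.prod (.list A.potential) C.complexity)) C.complexity) :=
    listStep_hasType ht₂
  have hsv : IsValue (.save .infty 0 (.lam N₂)) := .save .lam
  obtain ⟨_, e₁, hV₁⟩ := h₁
  cases e₁
  obtain ⟨_, e₂, hV₂⟩ := h₂
  cases e₂
  induction h with
  | nil hl =>
    intro n r w hw
    cases hw with
    | lrecNil hv hN₁ hN₂ hw =>
      obtain ⟨rfl, rfl, -⟩ := IsValue.nil.eq_of_eval hv
      obtain ⟨rfl, rfl, e⟩ := IsValue.lam.eq_of_eval hN₁
      cases e
      obtain ⟨rfl, rfl, -⟩ := hsv.eq_of_eval hN₂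
      simp only [add_zero, zero_add]
      refine (hV₁ 0 _ _ .triv rfl _ _ _ hw).mono ?_
        ((LamC.Le.lrecNil ht₁ hs).trans (.lrec hl ht₁ hs))
      rw [add_zero]
      exact le_self_add.trans le_add_self
    | lrecCons hv => cases hv
  | @cons a a₁ a₂ v₁ v₂ F₁ F₂ E ha htF₁ htF₂ hv₁ hv₂ hl ih =>
    intro n r w hw
    cases hw with
    | lrecNil hv => cases hv
    | lrecCons hv' hN₁ hN₂ hw =>
      have hv₂' : ValBound (.list A) a₂ v₂ F₂ := hv₂
      obtain ⟨rfl, rfl, e⟩ := (IsValue.cons hv₁.isValue hv₂'.isValue).eq_of_eval hv'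
      cases e
      obtain ⟨rfl, rfl, e⟩ := IsValue.lam.eq_of_eval hN₁
      cases e
      obtain ⟨rfl, rfl, e⟩ := hsv.eq_of_eval hN₂
      cases e
      simp only [add_zero, zero_add]
      have htR : LamC.HasType ![] (.lrec F₂ E₁ (listStep E₂)) C.complexity := .lrec htF₂ ht₁ hs
      have htQ := LamC.HasType.pair htF₂ htR
      have htP := LamC.HasType.pair htF₁ htQ
      have hP1 := LamC.Le.fstPair htF₁ htQ
      have hP2 := LamC.Le.sndPair htF₁ htQ
      have hP21 := (LamC.Le.fstPair htF₂ htR).trans (.fst hP2)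
      have hP22 := (LamC.Le.sndPair htF₂ htR).trans (.snd hP2)
      have hstep := LamC.Le.listStep ht₂ htP
      set P : LamC.Tm R 0 := .pair F₁ (.pair F₂ (.lrec F₂ E₁ (listStep E₂)))
      have htT : LamC.HasType ![] (.pair (.const 0) (.fst (.snd P))) (Ty.list A).complexity :=
        .pair (.const 0) (.fst (.snd htP))
      have htL : LamC.HasType ![] (.pair (.pair (.const 0) (.fst (.snd P))) (.snd (.snd P)))
          (Ty.amp (.list A) C).potential := .pair htT (.snd (.snd htP))
      have htl : ValBound (.list A) (a₂ + (b + ⊤ * c)) v₂ (.fst (.snd P)) :=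
        hv₂'.mono le_self_add hP21
      have hPb : ValBound (.tensor A (.amp (.list A) C)) (a₁ + (a₂ + (b + ⊤ * c)))
          (.pair v₁ (.lazyPair v₂ (.lrec v₂ (.lam N₁) (.save .infty 0 (.lam N₂)))))
          (.pair (.fst P) (.pair (.pair (.const 0) (.fst (.snd P))) (.snd (.snd P)))) := by
        have hproj := LamC.Le.sndPair (.fst htP) htL
        exact ⟨a₁, a₂ + (b + ⊤ * c), _, _, rfl, le_rfl,
          hv₁.mono le_rfl (hP1.trans (.fstPair (.fst htP) htL)), _, _, rfl,
          (htl.termBound (.fst (.snd htP))).mono le_rfl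
            ((LamC.Le.fstPair htT (.snd (.snd htP))).trans (.fst hproj)),
          ih.mono le_rfl
            ((hP22.trans (.sndPair htT (.snd (.snd htP)))).trans (.snd hproj))⟩
      refine (hV₂ _ _ _ (.pair (.fst htP) htL) hPb _ _ _ hw).mono ?_
        ((hstep.trans (.lrecCons htF₁ htF₂ ht₁ hs)).trans (.lrec hl ht₁ hs))
      calc c + (a₁ + (a₂ + (b + ⊤ * c))) = a₁ + a₂ + (b + (c + ⊤ * c)) := by ac_rfl
        _ ≤ a + (b + ⊤ * c) := by rw [add_top_mul]; gcongr

/-- The credits left by the three arguments of a recursor, of which those of the step function,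
`⊤ * c`, were saved with multiplicity `∞`. -/
theorem credit_recursor_le {f g h b₁ b₂ b₃ c : ℕ∞} {r₁ r₂ r₃ r₄ : Balance}
    (h₁ : credit ℤ b₁ ≤ credit ℤ f + r₁) (h₂ : credit ℤ b₂ ≤ credit ℤ g + r₂)
    (h₃ : credit ℤ b₃ ≤ credit ℤ h + r₃) (hc : ⊤ * c + 0 ≤ b₃) :
    credit ℤ (b₁ + (b₂ + ⊤ * c)) + r₄ ≤ credit ℤ (f + g + h) + (r₁ + r₂ + r₃ + r₄) := by
  rw [add_zero] at hc
  rw [← add_assoc, ← add_assoc]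
  gcongr
  exact add_credit_le (add_credit_le h₁ h₂) ((ExtCost.credit_mono hc).trans h₃)

theorem TermBound.nrec {C : Ty} {f g h : ℕ∞} {M N₁ N₂ : Tm 0} {E E₁ E₂ : LamC.Tm R 0}
    (ht : LamC.HasType ![] E Ty.nat.complexity)
    (ht₁ : LamC.HasType ![] E₁ (Ty.lolli .one C).complexity)
    (ht₂ : LamC.HasType ![] E₂
      (Ty.bang .infty 0 (.lolli (.tensor .nat (.lolli .one C)) C)).complexity)
    (hM : TermBound (ValBound .nat) f M E) (hN₁ : TermBound (ValBound (.lolli .one C)) g N₁ E₁)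
    (hN₂ : TermBound (ValBound (.bang .infty 0 (.lolli (.tensor .nat (.lolli .one C)) C))) h N₂
      E₂) :
    TermBound (ValBound C) (f + g + h) (.nrec M N₁ N₂)
      (.addCost (.plus (.plus (.fst E) (.fst E₁)) (.fst E₂))
        (.nrec (.snd E) (.snd E₁) (natStep (.snd E₂)))) := by
  -- Both rules for the recursor have the same arguments, and they agree with the evaluation of
  -- the recursor on the values of the arguments.
  have key {n₁ n₂ n₃ n₄ : ℕ} {r₁ r₂ r₃ r₄ : Balance} {v w : Tm 0} {N₁' N₂' : Tm 1}
      (hv : Eval M n₁ r₁ v) (hw₁ : Eval N₁ n₂ r₂ (.lam N₁'))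
      (hw₂ : Eval N₂ n₃ r₃ (.save .infty 0 (.lam N₂')))
      (hw : Eval (.nrec v (.lam N₁') (.save .infty 0 (.lam N₂'))) n₄ r₄ w) :
      ResultBound (ValBound C) (f + g + h) (n₁ + n₂ + n₃ + n₄) (r₁ + r₂ + r₃ + r₄) w
        (.addCost (.plus (.plus (.fst E) (.fst E₁)) (.fst E₂))
          (.nrec (.snd E) (.snd E₁) (natStep (.snd E₂)))) := by
    obtain ⟨hc₁, b₁, hb₁, hV⟩ := hM _ _ _ hv
    obtain ⟨hc₂, b₂, hb₂, hV₁⟩ := hN₁ _ _ _ hw₁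
    obtain ⟨hc₃, b₃, hb₃, c, u, hu, hcb, hV₂⟩ := hN₂ _ _ _ hw₂
    cases hu
    have hnt := LamC.HasType.nrec (.snd ht) (.snd ht₁) (natStep_hasType (.snd ht₂))
    -- The credits `b₁` of the number are not needed.
    exact ((NatBound.nrec (.snd ht₁) (.snd ht₂) hV₁ hV₂ hV _ _ _ hw).mono
      (le_add_self (b := b₁)) (.refl hnt)).addCost
      (.plus (.plus (.fst ht) (.fst ht₁)) (.fst ht₂)) hnt
      ((hc₁.const_plus hc₂).const_plus hc₃) (by simp only [ExtCost.amort_add, le_refl])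
      (credit_recursor_le hb₁ hb₂ hb₃ hcb)
  intro n r w hw
  cases hw with
  | nrecZero hv hw₁ hw₂ hw =>
    refine key hv hw₁ hw₂ ?_
    simpa only [add_zero, zero_add] using
      Eval.nrecZero IsValue.zero.eval IsValue.lam.eval (IsValue.save .lam).eval hw
  | nrecSucc hv hw₁ hw₂ hw =>
    refine key hv hw₁ hw₂ ?_
    obtain ⟨-, b₁, -, hV⟩ := hM _ _ _ hv
    simpa only [add_zero, zero_add] using
      Eval.nrecSucc (NatBound.isValue hV).eval IsValue.lam.eval (IsValue.save .lam).eval hw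

theorem TermBound.lrec {A C : Ty} {f g h : ℕ∞} {M N₁ N₂ : Tm 0} {E E₁ E₂ : LamC.Tm R 0}
    (ht : LamC.HasType ![] E (Ty.list A).complexity)
    (ht₁ : LamC.HasType ![] E₁ (Ty.lolli .one C).complexity)
    (ht₂ : LamC.HasType ![] E₂
      (Ty.bang .infty 0 (.lolli (.tensor A (.amp (.list A) C)) C)).complexity)
    (hM : TermBound (ValBound (.list A)) f M E)
    (hN₁ : TermBound (ValBound (.lolli .one C)) g N₁ E₁)
    (hN₂ : TermBound (ValBound (.bang .infty 0 (.lolli (.tensor A (.amp (.list A) C)) C))) h N₂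
      E₂) :
    TermBound (ValBound C) (f + g + h) (.lrec M N₁ N₂)
      (.addCost (.plus (.plus (.fst E) (.fst E₁)) (.fst E₂))
        (.lrec (.snd E) (.snd E₁) (listStep (.snd E₂)))) := by
  have key {n₁ n₂ n₃ n₄ : ℕ} {r₁ r₂ r₃ r₄ : Balance} {v w : Tm 0} {N₁' N₂' : Tm 1}
      (hv : Eval M n₁ r₁ v) (hw₁ : Eval N₁ n₂ r₂ (.lam N₁'))
      (hw₂ : Eval N₂ n₃ r₃ (.save .infty 0 (.lam N₂')))
      (hw : Eval (.lrec v (.lam N₁') (.save .infty 0 (.lam N₂'))) n₄ r₄ w) :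
      ResultBound (ValBound C) (f + g + h) (n₁ + n₂ + n₃ + n₄) (r₁ + r₂ + r₃ + r₄) w
        (.addCost (.plus (.plus (.fst E) (.fst E₁)) (.fst E₂))
          (.lrec (.snd E) (.snd E₁) (listStep (.snd E₂)))) := by
    obtain ⟨hc₁, b₁, hb₁, hV⟩ := hM _ _ _ hv
    obtain ⟨hc₂, b₂, hb₂, hV₁⟩ := hN₁ _ _ _ hw₁
    obtain ⟨hc₃, b₃, hb₃, c, u, hu, hcb, hV₂⟩ := hN₂ _ _ _ hw₂
    cases hu
    exact (ListBound.lrec (.snd ht₁) (.snd ht₂) hV₁ hV₂ hV _ _ _ hw).addCost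
      (.plus (.plus (.fst ht) (.fst ht₁)) (.fst ht₂))
      (.lrec (.snd ht) (.snd ht₁) (listStep_hasType (.snd ht₂)))
      ((hc₁.const_plus hc₂).const_plus hc₃) (by simp only [ExtCost.amort_add, le_refl])
      (credit_recursor_le hb₁ hb₂ hb₃ hcb)
  intro n r w hw
  cases hw with
  | lrecNil hv hw₁ hw₂ hw =>
    refine key hv hw₁ hw₂ ?_
    simpa only [add_zero, zero_add] using
      Eval.lrecNil IsValue.nil.eval IsValue.lam.eval (IsValue.save .lam).eval hw
  | lrecCons hv hw₁ hw₂ hw =>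
    refine key hv hw₁ hw₂ ?_
    obtain ⟨-, b₁, -, hV⟩ := hM _ _ _ hv
    cases hV.isValue with
    | cons hv₁ hv₂ =>
    simpa only [add_zero, zero_add] using Eval.lrecCons (IsValue.cons hv₁ hv₂).eval
      IsValue.lam.eval (IsValue.save .lam).eval hw

end

/-! ### The fundamental theorem -/

/-- The number of credits that a resource term stands for, if each variable `i` stores `a i`
credits. -/
def Res.eval {n : ℕ} (f : Res n) (a : Fin n → ℕ∞) : ℕ∞ := ∑ i, f.1 i * a i + f.2

section Res

variable {n : ℕ} (f g : Res n) (a : Fin n → ℕ∞)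

theorem Res.eval_add : (f + g).eval a = f.eval a + g.eval a := by
  simp only [Res.eval, Prod.fst_add, Prod.snd_add, Pi.add_apply, add_mul, Finset.sum_add_distrib]
  ac_rfl

theorem Res.eval_smul (k : ℕ∞) : (k • f).eval a = k * f.eval a := by
  simp only [Res.eval, Prod.smul_fst, Prod.smul_snd, Pi.smul_apply, smul_eq_mul, mul_add,
    Finset.mul_sum, mul_assoc]

theorem Res.eval_credits (l : ℕ∞) : (Res.credits l : Res n).eval a = l := by
  simp [Res.eval, Res.credits]

theorem Res.eval_snoc (k b : ℕ∞) :
    (Res.snoc f k).eval (Matrix.vecCons b a) = f.eval a + k * b := by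
  simp only [Res.eval, Res.snoc, Fin.sum_univ_succ, Matrix.cons_val_zero, Matrix.cons_val_succ]
  ac_rfl

theorem Res.eval_mono {f g : Res n} (h : f ≤ g) : f.eval a ≤ g.eval a := by
  unfold Res.eval
  gcongr with i
  · exact h.1 i
  · exact h.2

theorem Res.le_eval {f : Res n} {i : Fin n} (h : 1 ≤ f.1 i) : a i ≤ f.eval a :=
  calc a i ≤ f.1 i * a i := le_mul_of_one_le_left' h
    _ ≤ ∑ i, f.1 i * a i :=
      Finset.single_le_sum (f := fun i => f.1 i * a i) (fun _ _ => zero_le) (Finset.mem_univ i)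
    _ ≤ f.eval a := le_self_add

end Res

/-- Values `σ` with credits `a`, bounded by the closed potentials `θ`, for the variables of
`Γ`. -/
structure EnvBound {R : Type*} [CommRing R] [LinearOrder R] {n : ℕ} (Γ : Ctx n) (a : Fin n → ℕ∞)
    (σ : Fin n → Tm 0) (θ : Fin n → LamC.Tm R 0) : Prop where
  hasType : ∀ i, LamC.HasType ![] (θ i) (Γ i).potential
  valBound : ∀ i, ValBound (Γ i) (a i) (σ i) (θ i)

section

variable {R : Type*} [CommRing R] [LinearOrder R]

theorem EnvBound.snoc {n : ℕ} {Γ : Ctx n} {a : Fin n → ℕ∞} {σ : Fin n → Tm 0}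
    {θ : Fin n → LamC.Tm R 0} (h : EnvBound Γ a σ θ) {A : Ty} {b : ℕ∞} {v : Tm 0}
    {E : LamC.Tm R 0} (ht : LamC.HasType ![] E A.potential) (hv : ValBound A b v E) :
    EnvBound (Γ.snoc A) (Matrix.vecCons b a) (Matrix.vecCons v σ) (Matrix.vecCons E θ) :=
  ⟨Fin.cases ht h.hasType, Fin.cases hv h.valBound⟩

theorem EnvBound.hasType_extract {n : ℕ} {Γ : Ctx n} {a : Fin n → ℕ∞} {σ : Fin n → Tm 0}
    {θ : Fin n → LamC.Tm R 0} (h : EnvBound Γ a σ θ) {f : Res n} {M : Tm n} {A : Ty}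
    (hM : HasType Γ f M A) : LamC.HasType ![] ((M.extract R).subst θ) A.complexity :=
  hM.extract.subst h.hasType

theorem EnvBound.hasType_extract_lift {n : ℕ} {Γ : Ctx n} {a : Fin n → ℕ∞} {σ : Fin n → Tm 0}
    {θ : Fin n → LamC.Tm R 0} (h : EnvBound Γ a σ θ) {f : Res (n + 1)} {M : Tm (n + 1)} {A B : Ty}
    (hM : HasType (Γ.snoc A) f M B) :
    LamC.HasType (LamC.Ctx.snoc ![] A.potential) ((M.extract R).subst (LamC.Tm.lift θ))
      B.complexity := by
  have := hM.extract (R := R)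
  rw [Ctx.potential_snoc] at this
  exact this.subst (LamC.HasType.lift h.hasType _)

variable [IsStrictOrderedRing R]

/-- The fundamental theorem of the logical relation: a typed term, closed by bounded values, is
bounded by its extracted recurrence, closed by the potentials that bound them. -/
theorem HasType.termBound {n : ℕ} {Γ : Ctx n} {f : Res n} {M : Tm n} {A : Ty}
    (h : HasType Γ f M A) {a : Fin n → ℕ∞} {σ : Fin n → Tm 0} {θ : Fin n → LamC.Tm R 0}
    (he : EnvBound Γ a σ θ) :
    TermBound (ValBound A) (f.eval a) (M.subst σ) ((M.extract R).subst θ) := by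
  induction h with
  | var i hi =>
    exact ((he.valBound i).mono (Res.le_eval a hi) (.refl (he.hasType i))).termBound
      (he.hasType i)
  | tick h ih => exact (ih he).tick (he.hasType_extract h)
  | create h ih =>
    have := ih he
    rw [Res.eval_add, Res.eval_credits] at this
    exact this.create (he.hasType_extract h)
  | spend h e ih =>
    rw [e, Res.eval_add, Res.eval_credits]
    exact (ih he).spend (he.hasType_extract h)
  | save h hg ih =>
    refine (ih he).save (he.hasType_extract h) ?_
    have := Res.eval_mono a hg
    rwa [Res.eval_add, Res.eval_smul, Res.eval_credits] at this
  | transfer h₁ h₂ e ih₁ ih₂ =>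
    have ht := he.hasType_extract h₁
    rw [e, Res.eval_add, Res.eval_smul]
    simp only [Tm.extract, LamC.Tm.addCost, LamC.Tm.subst, LamC.Tm.subst_subst1]
    refine TermBound.transfer ht ?_ (ih₁ he) fun c v hv => ?_
    · have := h₂.extract (R := R)
      rw [Ctx.potential_snoc] at this
      exact this.subst (LamC.HasType.vecCons he.hasType (.snd ht))
    · rw [Tm.subst_lift_subst1]
      have := ih₂ (he.snoc (.snd ht) hv)
      rw [Res.eval_snoc, Res.eval_add, Res.eval_credits] at this
      convert this using 1
      ring
  | lam h ih =>
    have ht := he.hasType_extract_lift h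
    refine ValBound.termBound ⟨_, rfl, fun b u E' ht' hu => ?_⟩ (.lam ht)
    rw [Tm.subst_lift_subst1]
    have := ih (he.snoc ht' hu)
    rw [Res.eval_snoc, one_mul] at this
    refine this.mono le_rfl ?_
    rw [← LamC.Tm.subst_lift_subst1]
    exact .beta ht ht'
  | app h₁ h₂ e ih₁ ih₂ =>
    rw [e, Res.eval_add]
    exact (ih₁ he).app (he.hasType_extract h₁) (he.hasType_extract h₂) (ih₂ he)
  | pair h₁ h₂ e ih₁ ih₂ =>
    rw [e, Res.eval_add]
    exact (ih₁ he).pair (he.hasType_extract h₁) (he.hasType_extract h₂) (ih₂ he)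
  | letPair h₁ h₂ e ih₁ ih₂ =>
    have ht := he.hasType_extract h₁
    rw [e, Res.eval_add, Res.eval_smul]
    simp only [Tm.extract, LamC.Tm.addCost, LamC.Tm.subst, LamC.Tm.subst_subst2]
    refine TermBound.letPair ht ?_ (ih₁ he) fun b₁ b₂ v₁ v₂ hv₁ hv₂ => ?_
    · have := h₂.extract (R := R)
      rw [Ctx.potential_snoc, Ctx.potential_snoc] at this
      exact this.subst (LamC.HasType.vecCons (LamC.HasType.vecCons he.hasType (.fst (.snd ht)))
        (.snd (.snd ht)))
    · rw [Tm.subst_lift_subst2]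
      have := ih₂ ((he.snoc (.fst (.snd ht)) hv₁).snoc (.snd (.snd ht)) hv₂)
      rw [Res.eval_snoc, Res.eval_snoc, add_assoc, ← mul_add] at this
      exact this
  | lazyPair h₁ h₂ ih₁ ih₂ =>
    have ht₁ := he.hasType_extract h₁
    have ht₂ := he.hasType_extract h₂
    exact ValBound.termBound ⟨_, _, rfl, (ih₁ he).mono le_rfl (.fstPair ht₁ ht₂),
      (ih₂ he).mono le_rfl (.sndPair ht₁ ht₂)⟩ (.pair ht₁ ht₂)
  | fst h ih => exact (ih he).fst (he.hasType_extract h)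
  | snd h ih => exact (ih he).snd (he.hasType_extract h)
  | inl h ih => exact (ih he).inl (he.hasType_extract h)
  | inr h ih => exact (ih he).inr (he.hasType_extract h)
  | caseOf h h₁ h₂ e ih ih₁ ih₂ =>
    rw [e, Res.eval_add, Res.eval_smul]
    refine TermBound.caseOf (he.hasType_extract h) (he.hasType_extract_lift h₁)
      (he.hasType_extract_lift h₂) (ih he) (fun b v E' ht' hv => ?_) fun b v E' ht' hv => ?_
    · have := ih₁ (he.snoc ht' hv)
      rwa [Tm.subst_lift_subst1, LamC.Tm.subst_lift_subst1, ← Res.eval_snoc]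
    · have := ih₂ (he.snoc ht' hv)
      rwa [Tm.subst_lift_subst1, LamC.Tm.subst_lift_subst1, ← Res.eval_snoc]
  | triv => exact ValBound.termBound (A := .one) rfl .triv
  | zero => exact ValBound.termBound (A := .nat) (NatBound.zero (.refl .zero)) .zero
  | succ h ih => exact (ih he).succ (he.hasType_extract h)
  | nrec h h₁ h₂ e ih ih₁ ih₂ =>
    rw [e, Res.eval_add, Res.eval_add]
    have := (ih he).nrec (he.hasType_extract h) (he.hasType_extract h₁) (he.hasType_extract h₂)
      (ih₁ he) (ih₂ he)
    have hs (E : LamC.Tm R _) : natStep (.snd (E.subst θ)) = (natStep (.snd E)).subst θ :=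
      (natStep_subst θ (.snd E)).symm
    rw [hs] at this
    exact this
  | nil => exact ValBound.termBound (A := .list _) (ListBound.nil (.refl .nil)) .nil
  | cons h₁ h₂ e ih₁ ih₂ =>
    rw [e, Res.eval_add]
    exact (ih₁ he).cons (he.hasType_extract h₁) (he.hasType_extract h₂) (ih₂ he)
  | lrec h h₁ h₂ e ih ih₁ ih₂ =>
    rw [e, Res.eval_add, Res.eval_add]
    have := (ih he).lrec (he.hasType_extract h) (he.hasType_extract h₁) (he.hasType_extract h₂)
      (ih₁ he) (ih₂ he)
    have hs (E : LamC.Tm R _) : listStep (.snd (E.subst θ)) = (listStep (.snd E)).subst θ :=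
      (listStep_subst θ (.snd E)).symm
    rw [hs] at this
    exact this

end

end LamA

theorem mainTheorem2 {R : Type*} [CommRing R] [LinearOrder R] [IsStrictOrderedRing R]
    (M v : LamA.Tm 0) (A : LamA.Ty) (n : ℕ) (r : Balance)
    (hM : LamA.HasType ![] (LamA.Res.credits 0) M A)
    (hv : LamA.Eval M n r v) :
    LamC.Le ![] .cost (.const (ExtCost.fin (n : R))) (.fst (M.extract R)) := by
  have h := hM.termBound (R := R) (a := Fin.elim0) (σ := .var) (θ := .var)
    ⟨fun i => i.elim0, fun i => i.elim0⟩
  rw [LamA.Tm.subst_var, LamC.Tm.subst_var, LamA.Res.eval_credits] at h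
  obtain ⟨hc, b, hb, -⟩ := h n r v hv
  -- No credits were available at the start, so the balance is not negative.
  have hr : 0 ≤ r := by
    rw [ExtCost.credit_zero, zero_add] at hb
    exact (ExtCost.credit_nonneg b).trans hb
  refine (LamC.Le.const ?_).trans hc
  have := ExtCost.ofInt_strictMono (R := R).monotone hr
  rw [map_zero] at this
  exact le_add_of_nonneg_right this
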